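/- **Setting.** Let $(X,\mathcal X,m,T,w,\Gamma)$ be a Group Random Element Generator (Greg): $(X,\mathcal X,m)$ is a standard probability space, $T:X\to X$ is an invertible measure preserving transformation, $\Gamma$ is a locally compact second countable (Hausdorff) group and $w:X\to\Gamma$ is measurable. Let $w_n:X\to\Gamma$ ($n\in\mathbb Z$) be the cocycle with $w_0=1$, $w_1=w$, $w_{n+k}(x)=w_k(T^nx)\,w_n(x)$. Fix a probability measure $m_\Gamma^1$ on $\Gamma$ in the Haar measure class, put $j(x,g)=(w_n(x)g^{-1})_{n\in\mathbb Z}\in\Gamma^{\mathbb Z}$ and $\tilde m^1=j_*(m\times m_\Gamma^1)$, and let $\tilde m^1_+$, $\tilde m^1_-$ be the marginals of $\tilde m^1$ on the coordinates $n\ge 0$ and $n\le -1$. The group $\Gamma$ acts on all three sequence spaces by $g:(\gamma_i)\mapsto(\gamma_ig^{-1})$, commuting with the shift $\tilde T:(\gamma_i)\mapsto(\gamma_{i+1})$ on $\Gamma^{\mathbb Z}$ and on futures $(\gamma_n)_{n\ge0}$, and with the shift $(\gamma_i)\mapsto(\gamma_{i-1})$ on pasts $(\gamma_n)_{n\le-1}$.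 Let $(E,\eta)$, $(E_+,\eta_+)$, $(E_-,\eta_-)$ be the spaces of ergodic components of these shifts on $(\Gamma^{\mathbb Z},\tilde m^1)$, on the space of futures with $\tilde m^1_+$ and on the space of pasts with $\tilde m^1_-$; that is, the factors corresponding to the $\sigma$-algebras of shift invariant sets (modulo null sets), with the image measures and the induced $\Gamma$-actions. Let $\beta_\pm:\Gamma^{\mathbb Z}\to E_\pm$ be the resulting maps and $\pi_\pm:E\to E_\pm$ the induced factor maps. Assume that the Greg is Apafic: $(\beta_+\times\beta_-)_*\tilde m^1$ has the same null sets as $\eta_+\times\eta_-$. **Theorem.** $(E,E_+,E_-,\pi_+,\pi_-)$ is a boundary system for $\Gamma$. That is, $E,E_+,E_-$ are Lebesgue spaces with non-singular $\Gamma$-actions, $\pi_\pm$ are $\Gamma$-maps, and: 1. The actions of $\Gamma$ on $E$, $E_+$ and $E_-$ are amenable in the sense of Zimmer: for every continuous action of $\Gamma$ by affine maps on a non-empty metrizable compact convex space $Q$ (one isomorphic to a closed convex subset of $[0,1]^{\mathbb N}$) there is a $\Gamma$-map from the given space to $Q$. 2. $\pi_+$ and $\pi_-$ are relatively metrically ergodic: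 for $p=\pi_\pm:A=E\to B=E_\pm$, for all standard Borel spaces $W,V$ with measurable $\Gamma$-actions, every $\Gamma$-equivariant Borel map $q:W\to V$, every $\Gamma$-invariant Borel function $d:W\times_VW\to[0,\infty]$ that restricts to a separable metric on each fibre of $q$, and all $\Gamma$-maps $F:A\to W$, $f:B\to V$ with $q\circ F=f\circ p$ a.e., there is a $\Gamma$-map $\phi:B\to W$ with $F=\phi\circ p$ a.e. 3. $\pi_+\times\pi_-:E\to E_+\times E_-$ is measure class preserving: $(\pi_+\times\pi_-)_*\eta$ has the same null sets as $\eta_+\times\eta_-$. Here a $\Gamma$-map is a measurable map that for each $g\in\Gamma$ commutes with the action of $g$ almost everywhere. -/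

import Mathlib

open MeasureTheory Filter Topology Set
open scoped ENNReal

universe v

/-! ### Measure classes and non-singular actions -/

/-- Two measures define the same measure class, i.e. they have the same null sets. -/
def SameMeasureClass {A : Type*} [MeasurableSpace A] (μ ν : Measure A) : Prop :=
  μ ≪ ν ∧ ν ≪ μ

/-- `a : Γ → A → A` is a non-singular action of `Γ` on the measure space `(A, α)`: it is jointly
measurable, satisfies the action identities almost everywhere, and every group element preserves
the measure class of `α`. -/
structure IsNonsingularAction {Γ A : Type*} [Group Γ] [MeasurableSpace Γ] [MeasurableSpace A]
    (a : Γ → A → A) (α : Measure A) : Prop where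
  measurable : Measurable (fun p : Γ × A => a p.1 p.2)
  one : ∀ᵐ x ∂α, a 1 x = x
  mul : ∀ g h : Γ, ∀ᵐ x ∂α, a (g * h) x = a g (a h x)
  map : ∀ g : Γ, SameMeasureClass (α.map (a g)) α

/-- `f` represents an element of `Map_Γ(A, B)`, where `Γ` acts on `A` by `a` and on `B` by `b`:
it is measurable, and equivariant up to null sets of `α`. -/
structure IsGammaMap {Γ A B : Type*} [MeasurableSpace A] [MeasurableSpace B]
    (a : Γ → A → A) (α : Measure A) (b : Γ → B → B) (f : A → B) : Prop where
  measurable : Measurable f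
  equivariant : ∀ g : Γ, ∀ᵐ x ∂α, f (a g x) = b g (f x)

/-! ### Zimmer amenability -/

/-- Amenability in the sense of Zimmer: for every metrizable compact convex space `Q` (i.e. a
non-empty closed convex subset of the Hilbert cube) with a continuous action of `Γ` by affine
maps, there is a `Γ`-map `A → Q`. -/
def IsZimmerAmenable {Γ A : Type*} [Group Γ] [TopologicalSpace Γ] [MeasurableSpace A]
    (a : Γ → A → A) (α : Measure A) : Prop :=
  ∀ (Q : Set (ℕ → ℝ)), Q ⊆ Set.Icc 0 1 → IsClosed Q → Convex ℝ Q → Q.Nonempty →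
    ∀ [MulAction Γ Q] [ContinuousSMul Γ Q],
      (∀ (g : Γ) (x y z : Q) (s t : ℝ), 0 ≤ s → 0 ≤ t → s + t = 1 →
        (z : ℕ → ℝ) = s • (x : ℕ → ℝ) + t • (y : ℕ → ℝ) →
        ((g • z : Q) : ℕ → ℝ) = s • ((g • x : Q) : ℕ → ℝ) + t • ((g • y : Q) : ℕ → ℝ)) →
      ∃ φ : A → Q, IsGammaMap a α (fun g q => g • q) φ

/-! ### Relative metric ergodicity -/

/-- A `Γ`-equivariant separable metric extension `q : W → V`. The function `d` is only relevant
on the fibre product `W ×_V W`; the value `∞` is allowed. -/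
structure SeparableMetricExtension (Γ W V : Type*) [Group Γ] [MulAction Γ W] [MulAction Γ V]
    [MeasurableSpace W] [MeasurableSpace V] where
  q : W → V
  measurable_q : Measurable q
  q_smul : ∀ (g : Γ) (x : W), q (g • x) = g • q x
  d : W → W → ℝ≥0∞
  measurable_d : Measurable (fun p : {p : W × W // q p.1 = q p.2} => d p.1.1 p.1.2)
  d_eq_zero_iff : ∀ x y, q x = q y → (d x y = 0 ↔ x = y)
  d_comm : ∀ x y, q x = q y → d x y = d y x
  d_triangle : ∀ x y z, q x = q y → q y = q z → d x z ≤ d x y + d y z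
  separable : ∀ v : V, ∃ S : Set W, S.Countable ∧ (∀ s ∈ S, q s = v) ∧
    ∀ x, q x = v → ∀ ε : ℝ≥0∞, 0 < ε → ∃ s ∈ S, d x s < ε
  d_smul : ∀ (g : Γ) (x y : W), q x = q y → d (g • x) (g • y) = d x y

/-- The `Γ`-map `p : (A, α) → (B, β)` is relatively metrically ergodic. -/
def IsRelMetricallyErgodic {Γ A B : Type*} [Group Γ] [MeasurableSpace Γ]
    [MeasurableSpace A] [MeasurableSpace B]
    (a : Γ → A → A) (α : Measure A) (b : Γ → B → B) (β : Measure B) (p : A → B) : Prop :=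
  ∀ (W V : Type v) [MeasurableSpace W] [StandardBorelSpace W]
    [MeasurableSpace V] [StandardBorelSpace V]
    [MulAction Γ W] [MeasurableSMul₂ Γ W] [MulAction Γ V] [MeasurableSMul₂ Γ V]
    (ext : SeparableMetricExtension Γ W V) (F : A → W) (f : B → V),
    IsGammaMap a α (fun g x => g • x) F → IsGammaMap b β (fun g x => g • x) f →
    (∀ᵐ x ∂α, ext.q (F x) = f (p x)) →
    ∃ φ : B → W, IsGammaMap b β (fun g x => g • x) φ ∧ ∀ᵐ x ∂α, F x = φ (p x)

/-! ### Boundary systems -/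

/-- The `Γ`-spaces `(B, η)`, `(Bp, ηp)`, `(Bm, ηm)` and the maps `πp : B → Bp`, `πm : B → Bm` form
a boundary system for `Γ`. -/
structure IsBoundarySystem {Γ B Bp Bm : Type*} [Group Γ] [TopologicalSpace Γ] [MeasurableSpace Γ]
    [MeasurableSpace B] [StandardBorelSpace B] [MeasurableSpace Bp] [StandardBorelSpace Bp]
    [MeasurableSpace Bm] [StandardBorelSpace Bm]
    (a : Γ → B → B) (η : Measure B) (ap : Γ → Bp → Bp) (ηp : Measure Bp)
    (am : Γ → Bm → Bm) (ηm : Measure Bm) (πp : B → Bp) (πm : B → Bm) : Prop where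
  nonsingular : IsNonsingularAction a η
  nonsingular_pos : IsNonsingularAction ap ηp
  nonsingular_neg : IsNonsingularAction am ηm
  gammaMap_pos : IsGammaMap a η ap πp
  gammaMap_neg : IsGammaMap a η am πm
  amenable : IsZimmerAmenable a η
  amenable_pos : IsZimmerAmenable ap ηp
  amenable_neg : IsZimmerAmenable am ηm
  relMetricallyErgodic_pos : IsRelMetricallyErgodic.{v} a η ap ηp πp
  relMetricallyErgodic_neg : IsRelMetricallyErgodic.{v} a η am ηm πm
  sameMeasureClass : SameMeasureClass (η.map (fun x => (πp x, πm x))) (ηp.prod ηm)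

/-! ### Ergodic components -/

/-- The space of ergodic components `Ω // S` of a non-singular transformation `S` of `(Ω, μ)` (or
of the action of the semigroup, resp. group, that it generates), together with the action induced
on it by a non-singular action `ρ` of `Γ` on `Ω` that commutes with `S`. It is the factor
`factor : Ω → E` of `(Ω, μ)` that corresponds to the complete `σ`-algebra of the (up to null sets)
`S`-invariant measurable sets, and `act` is the action of `Γ` on `E` for which `factor` is
equivariant. These data are unique up to isomorphism and null sets; they exist by
`nonempty_ergodicComponents`. -/
structure ErgodicComponents {Γ Ω : Type*} [MeasurableSpace Γ] [MeasurableSpace Ω]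
    (μ : Measure Ω) (S : Ω → Ω) (ρ : Γ → Ω → Ω)
    (E : Type*) [MeasurableSpace E] [StandardBorelSpace E] where
  factor : Ω → E
  measurable_factor : Measurable factor
  invariant_iff : ∀ A : Set Ω, MeasurableSet A →
    (S ⁻¹' A =ᵐ[μ] A ↔ ∃ B : Set E, MeasurableSet B ∧ A =ᵐ[μ] factor ⁻¹' B)
  act : Γ → E → E
  measurable_act : Measurable (fun p : Γ × E => act p.1 p.2)
  factor_equivariant : ∀ g : Γ, ∀ᵐ x ∂μ, factor (ρ g x) = act g (factor x)

/-- The measure on the space of ergodic components. -/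
noncomputable def ErgodicComponents.measure {Γ Ω : Type*} [MeasurableSpace Γ] [MeasurableSpace Ω]
    {μ : Measure Ω} {S : Ω → Ω} {ρ : Γ → Ω → Ω}
    {E : Type*} [MeasurableSpace E] [StandardBorelSpace E]
    (P : ErgodicComponents μ S ρ E) : Measure E :=
  μ.map P.factor

/-! ### Group random element generators -/

/-- A group random element generator `(X, m, T, w, Γ)`. -/
structure Greg (X Γ : Type*) [MeasurableSpace X] [StandardBorelSpace X] [Group Γ]
    [TopologicalSpace Γ] [IsTopologicalGroup Γ] [LocallyCompactSpace Γ]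
    [SecondCountableTopology Γ] [T2Space Γ] [MeasurableSpace Γ] [BorelSpace Γ] where
  m : Measure X
  isProbabilityMeasure : IsProbabilityMeasure m
  T : X ≃ᵐ X
  measurePreserving : MeasurePreserving T m m
  w : X → Γ
  measurable_w : Measurable w

section Walks

variable {Γ : Type*} [Group Γ]

/-- The shift `(γ_n) ↦ (γ_{n+1})` on bi-infinite sequences. -/
def shiftZ (γ : ℤ → Γ) : ℤ → Γ := fun n => γ (n + 1)

/-- The shift `(γ_k) ↦ (γ_{k+1})` on one-sided sequences. -/
def shiftN (γ : ℕ → Γ) : ℕ → Γ := fun k => γ (k + 1)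

/-- The action of `Γ` on sequences in `Γ`, `g : (γ_i) ↦ (γ_i g⁻¹)`. -/
def rightAct {ι : Type*} (g : Γ) (γ : ι → Γ) : ι → Γ := fun i => γ i * g⁻¹

/-- The future `(γ_0, γ_1, …)` of a bi-infinite sequence. -/
def future (γ : ℤ → Γ) : ℕ → Γ := fun k => γ k

/-- The past `(γ_{-1}, γ_{-2}, …)` of a bi-infinite sequence; on pasts, `shiftN` is the shift
backwards in time. -/
def past (γ : ℤ → Γ) : ℕ → Γ := fun k => γ (-1 - k)

end Walks

namespace Greg

variable {X Γ : Type*} [MeasurableSpace X] [StandardBorelSpace X] [Group Γ]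
    [TopologicalSpace Γ] [IsTopologicalGroup Γ] [LocallyCompactSpace Γ]
    [SecondCountableTopology Γ] [T2Space Γ] [MeasurableSpace Γ] [BorelSpace Γ]

/-- `w_n(x) = w(T^{n-1} x) ⋯ w(T x) w(x)` for `n ≥ 0`. -/
def cocycleNat (G : Greg X Γ) : ℕ → X → Γ
  | 0, _ => 1
  | n + 1, x => G.w (G.T^[n] x) * G.cocycleNat n x

/-- The cocycle `w_n(x)`, `n ∈ ℤ`, generated by `w`; for `n < 0` it is `w_{-n}(T^n x)⁻¹`. -/
def cocycle (G : Greg X Γ) : ℤ → X → Γ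
  | Int.ofNat n, x => G.cocycleNat n x
  | Int.negSucc n, x => (G.cocycleNat (n + 1) (G.T.symm^[n + 1] x))⁻¹

/-- The random walk map `j(x, g) = (w_n(x) g⁻¹)_{n ∈ ℤ}`. -/
def walk (G : Greg X Γ) (p : X × Γ) : ℤ → Γ := fun n => G.cocycle n p.1 * p.2⁻¹

/-- The law of the random walk, the push-forward of `m × ν` under `j`. -/
noncomputable def walkMeasure (G : Greg X Γ) (ν : Measure Γ) : Measure (ℤ → Γ) :=
  (G.m.prod ν).map G.walk

/-- The space of ergodic components of the shift on bi-infinite walks. -/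
abbrev FullSpace (G : Greg X Γ) (ν : Measure Γ) (E : Type*) [MeasurableSpace E]
    [StandardBorelSpace E] :=
  ErgodicComponents (G.walkMeasure ν) shiftZ (rightAct : Γ → (ℤ → Γ) → (ℤ → Γ)) E

/-- The space of ideal futures, the ergodic components of the shift on futures of walks. -/
abbrev IdealFuture (G : Greg X Γ) (ν : Measure Γ) (E : Type*) [MeasurableSpace E]
    [StandardBorelSpace E] :=
  ErgodicComponents ((G.walkMeasure ν).map future) shiftN (rightAct : Γ → (ℕ → Γ) → (ℕ → Γ)) E

/-- The space of ideal pasts, the ergodic components of the shift on pasts of walks. -/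
abbrev IdealPast (G : Greg X Γ) (ν : Measure Γ) (E : Type*) [MeasurableSpace E]
    [StandardBorelSpace E] :=
  ErgodicComponents ((G.walkMeasure ν).map past) shiftN (rightAct : Γ → (ℕ → Γ) → (ℕ → Γ)) E

/-- Asymptotic past and future independence: the joint law of the ideal future and the ideal past
of a random walk is equivalent to the product of its marginals. -/
def IsApafic (G : Greg X Γ) (ν : Measure Γ) {Ep Em : Type*} [MeasurableSpace Ep]
    [StandardBorelSpace Ep] [MeasurableSpace Em] [StandardBorelSpace Em]
    (Pp : G.IdealFuture ν Ep) (Pm : G.IdealPast ν Em) : Prop :=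
  SameMeasureClass
    ((G.walkMeasure ν).map (fun γ => (Pp.factor (future γ), Pm.factor (past γ))))
    (Pp.measure.prod Pm.measure)

end Greg

/-! ### Existence

The spaces of ergodic components, in particular the spaces of ideal pasts and futures, and the maps
between them exist, so that the structures above are never void. -/

section Existence
open ProbabilityTheory

variable {Γ Ω : Type*} [MeasurableSpace Γ] [MeasurableSpace Ω] [StandardBorelSpace Ω]
    {μ : Measure Ω} [IsProbabilityMeasure μ]

theorem exists_generating_map (J : Set (Set Ω)) (hJ : ∀ A ∈ J, MeasurableSet A) (hne : J.Nonempty) :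
    ∃ A : ℕ → Set Ω, (∀ n, A n ∈ J) ∧ ∀ C ∈ J, ∃ B : Set (ℕ → ℝ), MeasurableSet B ∧
      C =ᵐ[μ] (fun x n => (A n).indicator (fun _ => (1 : ℝ)) x) ⁻¹' B := by
  classical
  let f : J → Lp ℝ 1 μ := fun A => indicatorConstLp 1 (hJ A.1 A.2) (measure_ne_top μ _) (1 : ℝ)
  have : Nonempty J := hne.to_subtype
  let : TopologicalSpace J := TopologicalSpace.induced f inferInstance
  have : Fact ((1 : ℝ≥0∞) ≠ ∞) := ⟨by simp⟩
  have : SecondCountableTopology J := TopologicalSpace.secondCountableTopology_induced _ _ f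
  let A : ℕ → J := TopologicalSpace.denseSeq J
  refine ⟨fun n => (A n).1, fun n => (A n).2, fun C hC => ?_⟩
  have hcl : f ⟨C, hC⟩ ∈ closure (f '' Set.range A) := by
    have h1 : (⟨C, hC⟩ : J) ∈ closure (Set.range A) := TopologicalSpace.denseRange_denseSeq J _
    have hfc : Continuous f := continuous_induced_dom
    exact image_closure_subset_closure_image hfc ⟨_, h1, rfl⟩
  obtain ⟨u, hu, hlim⟩ := mem_closure_iff_seq_limit.1 hcl
  have : ∀ k, ∃ n, f (A n) = u k := by
    intro k
    obtain ⟨_, ⟨n, rfl⟩, h⟩ := hu k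
    exact ⟨n, h⟩
  choose n hn using this
  obtain ⟨ns, -, hns⟩ := (tendstoInMeasure_of_tendsto_Lp hlim).exists_seq_tendsto_ae
  refine ⟨{e | Tendsto (fun k => e (n (ns k))) atTop (𝓝 1)}, ?_, ?_⟩
  · exact measurableSet_tendsto _ (fun k => measurable_pi_apply _)
  · have h2 : ∀ᵐ x ∂μ, ∀ k, (u (ns k) : Ω → ℝ) x =
        ((A (n (ns k))).1).indicator (fun _ => (1 : ℝ)) x := by
      rw [ae_all_iff]
      intro k
      rw [← hn (ns k)]
      exact indicatorConstLp_coeFn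
    have h3 : ∀ᵐ x ∂μ, (f ⟨C, hC⟩ : Ω → ℝ) x = C.indicator (fun _ => (1 : ℝ)) x :=
      indicatorConstLp_coeFn
    filter_upwards [hns, h2, h3] with x hx h2 h3
    rw [h3] at hx
    simp only [h2] at hx
    apply propext
    change x ∈ C ↔ Tendsto (fun k => ((A (n (ns k))).1).indicator (fun _ => (1 : ℝ)) x) atTop (𝓝 1)
    constructor
    · intro hxC
      simpa [hxC] using hx
    · intro h
      by_contra hxC
      have := tendsto_nhds_unique h hx
      simp [hxC] at this

theorem condDistrib_real_of_ae_eq {E : Type*} [MeasurableSpace E] {β : Ω → E} (hβ : Measurable β)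
    [Nonempty Ω] {C : Set Ω} (hC : MeasurableSet C) {B : Set E} (hB : MeasurableSet B)
    (h : C =ᵐ[μ] β ⁻¹' B) :
    ∀ᵐ x ∂μ, (condDistrib id β μ (β x)).real C = C.indicator (fun _ => (1 : ℝ)) x := by
  have h1 := condDistrib_ae_eq_condExp (μ := μ) hβ measurable_id hC
  have hi : C.indicator (fun _ => (1 : ℝ)) =ᵐ[μ] (β ⁻¹' B).indicator (fun _ => (1 : ℝ)) :=
    indicator_ae_eq_of_ae_eq_set h
  have h2 : μ⟦id ⁻¹' C | MeasurableSpace.comap β inferInstance⟧ =ᵐ[μ]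
      (β ⁻¹' B).indicator (fun _ => (1 : ℝ)) := by
    refine (condExp_congr_ae hi).trans ?_
    rw [condExp_of_stronglyMeasurable hβ.comap_le]
    · exact stronglyMeasurable_const.indicator ⟨B, hB, rfl⟩
    · exact (integrable_const _).indicator (hβ hB)
  filter_upwards [h1, h2, hi] with x h1 h2 h3
  rw [h1, h2, ← h3]

/-- The space of ergodic components exists. -/
theorem nonempty_ergodicComponents (S : Ω → Ω) (hS : Measure.QuasiMeasurePreserving S μ μ)
    (ρ : Γ → Ω → Ω) (hρ : Measurable (fun p : Γ × Ω => ρ p.1 p.2))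
    (hρ' : ∀ g, Measure.QuasiMeasurePreserving (ρ g) μ μ)
    (hcomm : ∀ g x, ρ g (S x) = S (ρ g x)) :
    Nonempty (ErgodicComponents μ S ρ (ℕ → ℝ)) := by
  classical
  have : Nonempty Ω := nonempty_of_isProbabilityMeasure μ
  let J : Set (Set Ω) := {A | MeasurableSet A ∧ S ⁻¹' A =ᵐ[μ] A}
  obtain ⟨A, hA, hgen⟩ := exists_generating_map (μ := μ) J (fun A h => h.1)
    ⟨∅, MeasurableSet.empty, by simp⟩
  let β : Ω → ℕ → ℝ := fun x n => (A n).indicator (fun _ => (1 : ℝ)) x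
  have hβ : Measurable β := measurable_pi_lambda _ fun n =>
    measurable_const.indicator (hA n).1
  have hinv : ∀ᵐ x ∂μ, β (S x) = β x := by
    have : ∀ᵐ x ∂μ, ∀ n, (S x ∈ A n ↔ x ∈ A n) := by
      rw [ae_all_iff]
      intro n
      filter_upwards [(hA n).2] with x hx
      exact iff_of_eq hx
    filter_upwards [this] with x hx
    funext n
    simp only [β, Set.indicator, hx n]
  have hJρ : ∀ g, ∀ C ∈ J, ρ g ⁻¹' C ∈ J := by
    intro g C hC
    refine ⟨(hρ' g).measurable hC.1, ?_⟩
    have := (hρ' g).preimage_ae_eq hC.2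
    have h2 : S ⁻¹' (ρ g ⁻¹' C) = ρ g ⁻¹' (S ⁻¹' C) := by
      ext x; simp [hcomm]
    rw [h2]; exact this
  refine ⟨{ factor := β, measurable_factor := hβ, invariant_iff := ?_,
            act := fun g e n => (condDistrib id β μ e).real (ρ g ⁻¹' (A n)),
            measurable_act := ?_, factor_equivariant := ?_ }⟩
  · intro C hC
    constructor
    · intro h
      exact hgen C ⟨hC, h⟩
    · rintro ⟨B, hB, h⟩
      refine (hS.preimage_ae_eq h).trans (EventuallyEq.trans ?_ h.symm)
      filter_upwards [hinv] with x hx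
      apply propext
      change β (S x) ∈ B ↔ β x ∈ B
      rw [hx]
  · refine measurable_pi_lambda _ fun n => ?_
    have hT : MeasurableSet {q : (Γ × (ℕ → ℝ)) × Ω | ρ q.1.1 q.2 ∈ A n} :=
      (hρ.comp (measurable_fst.fst.prodMk measurable_snd)) (hA n).1
    have := Kernel.measurable_kernel_prodMk_left
      (κ := (condDistrib id β μ).comap (Prod.snd : Γ × (ℕ → ℝ) → (ℕ → ℝ)) measurable_snd) hT
    exact this.ennreal_toReal
  · intro g
    have : ∀ᵐ x ∂μ, ∀ n, (condDistrib id β μ (β x)).real (ρ g ⁻¹' (A n)) =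
        (ρ g ⁻¹' (A n)).indicator (fun _ => (1 : ℝ)) x := by
      rw [ae_all_iff]
      intro n
      have hm := hJρ g _ (hA n)
      obtain ⟨B, hB, h⟩ := hgen _ hm
      exact condDistrib_real_of_ae_eq hβ hm.1 hB h
    filter_upwards [this] with x hx
    funext n
    rw [hx n]
    rfl


/-- A measurable map that is invariant up to null sets factors through the space of ergodic
components. -/
theorem ErgodicComponents.exists_factorization {S : Ω → Ω} {ρ : Γ → Ω → Ω}
    {E F : Type*} [MeasurableSpace E] [StandardBorelSpace E] [MeasurableSpace F]
    [StandardBorelSpace F] (P : ErgodicComponents μ S ρ E) (f : Ω → F) (hf : Measurable f)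
    (hfS : ∀ᵐ x ∂μ, f (S x) = f x) :
    ∃ π : E → F, Measurable π ∧ ∀ᵐ x ∂μ, π (P.factor x) = f x := by
  classical
  have : Nonempty Ω := nonempty_of_isProbabilityMeasure μ
  have : Nonempty F := this.map f
  let h : F → ℕ → Bool := MeasurableSpace.mapNatBool F
  have hh : Measurable h := MeasurableSpace.measurable_mapNatBool F
  have he : MeasurableEmbedding h :=
    hh.measurableEmbedding (MeasurableSpace.injective_mapNatBool F)
  obtain ⟨r, hr, hrh⟩ := he.exists_measurable_extend measurable_id (fun _ => inferInstance)
  have hC : ∀ n, ∃ B : Set E, MeasurableSet B ∧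
      {x | h (f x) n = true} =ᵐ[μ] P.factor ⁻¹' B := by
    intro n
    have hm : MeasurableSet {x | h (f x) n = true} :=
      ((measurable_pi_apply n).comp (hh.comp hf)) (measurableSet_singleton true)
    refine (P.invariant_iff _ hm).1 ?_
    filter_upwards [hfS] with x hx
    apply propext
    change h (f (S x)) n = true ↔ h (f x) n = true
    rw [hx]
  choose B hB hBC using hC
  refine ⟨fun e => r (fun n => decide (e ∈ B n)), ?_, ?_⟩
  · refine hr.comp (measurable_pi_lambda _ fun n => ?_)
    exact measurable_to_bool (by simpa [Set.preimage] using hB n)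
  · have := ae_all_iff.2 hBC
    filter_upwards [this] with x hx
    have h2 : (fun n => decide (P.factor x ∈ B n)) = h (f x) := by
      funext n
      have : (h (f x) n = true) ↔ P.factor x ∈ B n := iff_of_eq (hx n)
      by_cases hb : P.factor x ∈ B n
      · simp [hb, this.2 hb]
      · have h3 : h (f x) n = false := by
          rw [← Bool.not_eq_true]; exact fun h => hb (this.1 h)
        simp [hb, h3]
    change r (fun n => decide (P.factor x ∈ B n)) = f x
    rw [h2]
    exact congrFun hrh (f x)

end Existence

theorem quasiMeasurePreserving_map_of_semiconj {A B : Type*} [MeasurableSpace A]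
    [MeasurableSpace B] {μ : Measure A} {j : A → B} (hj : Measurable j) {φ : A → A}
    (hφ : Measure.QuasiMeasurePreserving φ μ μ) {f : B → B} (hf : Measurable f)
    (h : ∀ x, f (j x) = j (φ x)) : Measure.QuasiMeasurePreserving f (μ.map j) (μ.map j) := by
  refine ⟨hf, ?_⟩
  rw [Measure.map_map hf hj, show f ∘ j = j ∘ φ from funext h, ← Measure.map_map hj hφ.measurable]
  exact hφ.absolutelyContinuous.map hj

namespace Greg

variable {X Γ : Type*} [MeasurableSpace X] [StandardBorelSpace X] [Group Γ]
    [TopologicalSpace Γ] [IsTopologicalGroup Γ] [LocallyCompactSpace Γ]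
    [SecondCountableTopology Γ] [T2Space Γ] [MeasurableSpace Γ] [BorelSpace Γ]
    (G : Greg X Γ) (ν : Measure Γ)

theorem cocycleNat_succ (n : ℕ) (x : X) :
    G.cocycleNat (n + 1) x = G.cocycleNat n (G.T x) * G.w x := by
  induction n generalizing x with
  | zero => simp [cocycleNat]
  | succ n ih =>
    rw [cocycleNat, ih, ← mul_assoc, cocycleNat, Function.iterate_succ_apply]

theorem cocycle_add_one (n : ℤ) (x : X) :
    G.cocycle (n + 1) x = G.cocycle n (G.T x) * G.w x := by
  have hit : ∀ (k : ℕ) (y : X), G.T^[k] (G.T.symm^[k] y) = y := fun k =>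
    Function.LeftInverse.iterate (fun y => G.T.apply_symm_apply y) k
  rcases n with n | n
  · exact G.cocycleNat_succ n x
  · cases n with
    | zero =>
      change G.cocycle (Int.ofNat 0) x = _
      simp [cocycle, cocycleNat]
    | succ k =>
      change G.cocycle (Int.negSucc k) x = _
      simp only [cocycle]
      rw [Function.iterate_succ_apply _ (k + 1), G.T.symm_apply_apply]
      have h : ∀ y, G.cocycleNat (k + 1 + 1) y = G.w (G.T^[k + 1] y) * G.cocycleNat (k + 1) y :=
        fun y => rfl
      rw [h, hit, mul_inv_rev, mul_assoc, inv_mul_cancel, mul_one]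

theorem measurable_cocycleNat (n : ℕ) : Measurable (G.cocycleNat n) := by
  induction n with
  | zero => exact measurable_const
  | succ n ih => exact (G.measurable_w.comp (G.T.measurable.iterate n)).mul ih

theorem measurable_cocycle (n : ℤ) : Measurable (G.cocycle n) := by
  rcases n with n | n
  · exact G.measurable_cocycleNat n
  · exact ((G.measurable_cocycleNat (n + 1)).comp (G.T.symm.measurable.iterate (n + 1))).inv

theorem measurable_walk : Measurable G.walk :=
  measurable_pi_lambda _ fun n => ((G.measurable_cocycle n).comp measurable_fst).mul
    measurable_snd.inv

theorem shiftZ_walk (p : X × Γ) :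
    shiftZ (G.walk p) = G.walk (G.T p.1, p.2 * (G.w p.1)⁻¹) := by
  funext n
  simp [shiftZ, walk, cocycle_add_one, mul_assoc]

theorem rightAct_walk (h : Γ) (p : X × Γ) : rightAct h (G.walk p) = G.walk (p.1, h * p.2) := by
  funext n
  simp [rightAct, walk, mul_assoc]

variable {ν}

theorem quasiMeasurePreserving_mul_right' [IsProbabilityMeasure ν]
    (hν : SameMeasureClass ν Measure.haar) (g : Γ) :
    Measure.QuasiMeasurePreserving (fun h => h * g) ν ν :=
  (quasiMeasurePreserving_mul_right (Measure.haar : Measure Γ) g).mono hν.1 hν.2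

theorem quasiMeasurePreserving_mul_left' [IsProbabilityMeasure ν]
    (hν : SameMeasureClass ν Measure.haar) (g : Γ) :
    Measure.QuasiMeasurePreserving (fun h => g * h) ν ν :=
  (measurePreserving_mul_left (Measure.haar : Measure Γ) g).quasiMeasurePreserving.mono hν.1 hν.2

theorem quasiMeasurePreserving_skew [IsProbabilityMeasure ν]
    (hν : SameMeasureClass ν Measure.haar) {θ : X → X} (hθ : MeasurePreserving θ G.m G.m)
    {c : X → Γ} (hc : Measurable c) :
    Measure.QuasiMeasurePreserving (fun p : X × Γ => (θ p.1, p.2 * c p.1))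
      (G.m.prod ν) (G.m.prod ν) := by
  have := G.isProbabilityMeasure
  have hm : Measurable (fun p : X × Γ => (θ p.1, p.2 * c p.1)) :=
    (hθ.measurable.comp measurable_fst).prodMk (measurable_snd.mul (hc.comp measurable_fst))
  refine ⟨hm, Measure.AbsolutelyContinuous.mk fun s hs h0 => ?_⟩
  rw [Measure.map_apply hm hs, Measure.measure_prod_null (hm hs)]
  rw [Measure.measure_prod_null hs] at h0
  filter_upwards [hθ.quasiMeasurePreserving.ae h0] with x hx
  exact (quasiMeasurePreserving_mul_right' hν (c x)).preimage_null hx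

instance [IsProbabilityMeasure ν] : IsProbabilityMeasure (G.walkMeasure ν) := by
  have := G.isProbabilityMeasure
  exact Measure.isProbabilityMeasure_map G.measurable_walk.aemeasurable

end Greg

section
variable {Γ : Type*} [Group Γ] [TopologicalSpace Γ] [IsTopologicalGroup Γ]
    [SecondCountableTopology Γ] [MeasurableSpace Γ] [BorelSpace Γ]

theorem measurable_future : Measurable (future : (ℤ → Γ) → ℕ → Γ) :=
  measurable_pi_lambda _ fun _ => measurable_pi_apply _

theorem measurable_past : Measurable (past : (ℤ → Γ) → ℕ → Γ) :=
  measurable_pi_lambda _ fun _ => measurable_pi_apply _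

theorem measurable_shiftZ : Measurable (shiftZ : (ℤ → Γ) → ℤ → Γ) :=
  measurable_pi_lambda _ fun _ => measurable_pi_apply _

theorem measurable_shiftN : Measurable (shiftN : (ℕ → Γ) → ℕ → Γ) :=
  measurable_pi_lambda _ fun _ => measurable_pi_apply _

theorem measurable_rightAct {ι : Type*} :
    Measurable (fun p : Γ × (ι → Γ) => rightAct p.1 p.2) :=
  measurable_pi_lambda _ fun i =>
    ((measurable_pi_apply i).comp measurable_snd).mul measurable_fst.inv

end

namespace Greg

variable {X Γ : Type*} [MeasurableSpace X] [StandardBorelSpace X] [Group Γ]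
    [TopologicalSpace Γ] [IsTopologicalGroup Γ] [LocallyCompactSpace Γ]
    [SecondCountableTopology Γ] [T2Space Γ] [MeasurableSpace Γ] [BorelSpace Γ]
    (G : Greg X Γ) {ν : Measure Γ} [IsProbabilityMeasure ν]

/-- The inverse shift. -/
def unshiftZ {Γ : Type*} (γ : ℤ → Γ) : ℤ → Γ := fun n => γ (n - 1)

theorem quasiMeasurePreserving_shiftZ (hν : SameMeasureClass ν Measure.haar) :
    Measure.QuasiMeasurePreserving shiftZ (G.walkMeasure ν) (G.walkMeasure ν) :=
  quasiMeasurePreserving_map_of_semiconj G.measurable_walk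
    (G.quasiMeasurePreserving_skew hν G.measurePreserving G.measurable_w.inv) measurable_shiftZ
    G.shiftZ_walk

theorem quasiMeasurePreserving_unshiftZ (hν : SameMeasureClass ν Measure.haar) :
    Measure.QuasiMeasurePreserving unshiftZ (G.walkMeasure ν) (G.walkMeasure ν) := by
  refine quasiMeasurePreserving_map_of_semiconj G.measurable_walk
    (G.quasiMeasurePreserving_skew hν (G.measurePreserving.symm G.T)
      (G.measurable_w.comp G.T.symm.measurable))
    (measurable_pi_lambda _ fun _ => measurable_pi_apply _) fun p => ?_
  have h := G.shiftZ_walk (G.T.symm p.1, p.2 * G.w (G.T.symm p.1))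
  simp only [G.T.apply_symm_apply, mul_inv_cancel_right] at h
  funext n
  have := congrFun h (n - 1)
  simp only [shiftZ, sub_add_cancel] at this
  simpa [unshiftZ] using this.symm

theorem quasiMeasurePreserving_rightAct (hν : SameMeasureClass ν Measure.haar) (g : Γ) :
    Measure.QuasiMeasurePreserving (rightAct g) (G.walkMeasure ν) (G.walkMeasure ν) := by
  have := G.isProbabilityMeasure
  refine quasiMeasurePreserving_map_of_semiconj G.measurable_walk
    (φ := Prod.map id (fun h => g * h)) ?_
    (measurable_rightAct.comp measurable_prodMk_left) (fun p => G.rightAct_walk g p)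
  have hm : Measurable (Prod.map id (fun h => g * h) : X × Γ → X × Γ) :=
    measurable_id.prodMap (measurable_const_mul g)
  refine ⟨hm, Measure.AbsolutelyContinuous.mk fun s hs h0 => ?_⟩
  rw [Measure.map_apply hm hs, Measure.measure_prod_null (hm hs)]
  rw [Measure.measure_prod_null hs] at h0
  filter_upwards [h0] with x hx
  exact (quasiMeasurePreserving_mul_left' hν g).preimage_null hx

/-- For every Greg the spaces of the construction and the maps between them exist. -/
theorem exists_idealSpaces (hν : SameMeasureClass ν Measure.haar) :
    ∃ (P : G.FullSpace ν (ℕ → ℝ)) (Pp : G.IdealFuture ν (ℕ → ℝ)) (Pm : G.IdealPast ν (ℕ → ℝ))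
      (πp πm : (ℕ → ℝ) → (ℕ → ℝ)), Measurable πp ∧ Measurable πm ∧
      (∀ᵐ γ ∂(G.walkMeasure ν), πp (P.factor γ) = Pp.factor (future γ)) ∧
      (∀ᵐ γ ∂(G.walkMeasure ν), πm (P.factor γ) = Pm.factor (past γ)) := by
  have hf := measurable_future (Γ := Γ)
  have hp := measurable_past (Γ := Γ)
  have : IsProbabilityMeasure ((G.walkMeasure ν).map future) :=
    Measure.isProbabilityMeasure_map hf.aemeasurable
  have : IsProbabilityMeasure ((G.walkMeasure ν).map past) :=
    Measure.isProbabilityMeasure_map hp.aemeasurable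
  have : PolishSpace Γ := by
    let _ : UniformSpace Γ := IsTopologicalGroup.rightUniformSpace Γ
    have : IsRightUniformGroup Γ := ⟨rfl⟩
    have := IsRightUniformGroup.completeSpace_of_weaklyLocallyCompactSpace (G := Γ)
    have : (uniformity Γ).IsCountablyGenerated := by
      rw [uniformity_eq_comap_mul_inv_nhds_one]
      infer_instance
    infer_instance
  obtain ⟨P⟩ := nonempty_ergodicComponents shiftZ (G.quasiMeasurePreserving_shiftZ hν)
    (rightAct : Γ → (ℤ → Γ) → (ℤ → Γ)) measurable_rightAct
    (G.quasiMeasurePreserving_rightAct hν) (fun g x => rfl)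
  -- transport along `future` and `past`
  have key : ∀ (r : (ℤ → Γ) → ℕ → Γ) (_ : Measurable r) (f : (ℤ → Γ) → ℤ → Γ)
      (k : (ℕ → Γ) → ℕ → Γ) (_ : Measurable k),
      Measure.QuasiMeasurePreserving f (G.walkMeasure ν) (G.walkMeasure ν) →
      (∀ x, k (r x) = r (f x)) → Measure.QuasiMeasurePreserving k
        ((G.walkMeasure ν).map r) ((G.walkMeasure ν).map r) :=
    fun r hr f k hk hq h => quasiMeasurePreserving_map_of_semiconj hr hq hk h
  have hsf := key future hf shiftZ shiftN measurable_shiftN (G.quasiMeasurePreserving_shiftZ hν)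
    (fun x => by funext n; simp [shiftN, shiftZ, future])
  have hsp := key past hp unshiftZ shiftN measurable_shiftN
    (G.quasiMeasurePreserving_unshiftZ hν)
    (fun x => by
      funext n
      simp only [shiftN, unshiftZ, past]
      congr 1
      push_cast
      ring)
  obtain ⟨Pp⟩ := nonempty_ergodicComponents shiftN hsf
    (rightAct : Γ → (ℕ → Γ) → (ℕ → Γ)) measurable_rightAct
    (fun g => key future hf (rightAct g) (rightAct g) (measurable_rightAct.comp
      measurable_prodMk_left) (G.quasiMeasurePreserving_rightAct hν g) (fun x => rfl))
    (fun g x => rfl)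
  obtain ⟨Pm⟩ := nonempty_ergodicComponents shiftN hsp
    (rightAct : Γ → (ℕ → Γ) → (ℕ → Γ)) measurable_rightAct
    (fun g => key past hp (rightAct g) (rightAct g) (measurable_rightAct.comp
      measurable_prodMk_left) (G.quasiMeasurePreserving_rightAct hν g) (fun x => rfl))
    (fun g x => rfl)
  have inv : ∀ {r : (ℤ → Γ) → ℕ → Γ} (Q : ErgodicComponents ((G.walkMeasure ν).map r) shiftN
      (rightAct : Γ → (ℕ → Γ) → (ℕ → Γ)) (ℕ → ℝ)), Measurable r → 
      Measure.QuasiMeasurePreserving shiftN ((G.walkMeasure ν).map r) ((G.walkMeasure ν).map r) →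
      ∀ᵐ γ ∂(G.walkMeasure ν), Q.factor (shiftN (r γ)) = Q.factor (r γ) := by
    intro r Q hr hs
    obtain ⟨A, hA⟩ : ∃ A : ℕ → Set (ℕ → ℝ), (∀ n, MeasurableSet (A n)) ∧
        ∀ x y, (∀ n, x ∈ A n ↔ y ∈ A n) → x = y := by
      refine ⟨fun n => {e | MeasurableSpace.mapNatBool (ℕ → ℝ) e n = true}, fun n => ?_, ?_⟩
      · exact ((measurable_pi_apply n).comp (MeasurableSpace.measurable_mapNatBool (ℕ → ℝ)))
          (measurableSet_singleton true)
      · intro x y h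
        apply MeasurableSpace.injective_mapNatBool (ℕ → ℝ)
        funext n
        exact Bool.eq_iff_iff.2 (h n)
    have h1 : ∀ᵐ y ∂((G.walkMeasure ν).map r), Q.factor (shiftN y) = Q.factor y := by
      have : ∀ᵐ y ∂((G.walkMeasure ν).map r), ∀ n,
          (Q.factor (shiftN y) ∈ A n ↔ Q.factor y ∈ A n) := by
        rw [ae_all_iff]
        intro n
        have := (Q.invariant_iff _ (Q.measurable_factor (hA.1 n))).2 ⟨A n, hA.1 n, by rfl⟩
        filter_upwards [this] with y hy
        exact iff_of_eq hy
      filter_upwards [this] with y hy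
      exact hA.2 _ _ hy
    exact ae_of_ae_map hr.aemeasurable h1
  obtain ⟨πp, hπp, hπp'⟩ := P.exists_factorization (fun γ => Pp.factor (future γ))
    (Pp.measurable_factor.comp hf) (by
      filter_upwards [inv Pp hf hsf] with γ hγ
      rw [← hγ]; congr 1)
  obtain ⟨πm, hπm, hπm'⟩ := P.exists_factorization (fun γ => Pm.factor (past γ))
    (Pm.measurable_factor.comp hp) (by
      have := (G.quasiMeasurePreserving_shiftZ hν).ae (inv Pm hp hsp)
      filter_upwards [this] with γ hγ
      rw [← hγ]; congr 1
      funext n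
      simp only [past, shiftZ, shiftN]
      congr 1
      push_cast
      ring)
  exact ⟨P, Pp, Pm, πp, πm, hπp, hπm, hπp', hπm'⟩

end Greg

/-!
Non-singularity and the maps `π±` come directly from the definition of the ergodic components, and
asymptotic past and future independence is the last condition of a boundary system, because
`(π₊ × π₋)_* η` is the joint law of the ideal future and the ideal past. The content is in
amenability and relative metric ergodicity.

Amenability. For `q ∈ Q` the map `γ ↦ γ₀⁻¹ • q` is equivariant, hence so are its averages along the
shift, and these are more and more shift invariant. A subsequence of suitable convex combinations of
them converges almost everywhere: elements of almost minimal norm in decreasing bounded convex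
subsets of a Hilbert space form a Cauchy sequence (`exists_cauchySeq_of_antitone_midpoint`). As the
action on `Q` is affine and continuous, the limit is equivariant, and being invariant it descends to
the ergodic components (`ErgodicComponents.isZimmerAmenable`).

Relative metric ergodicity. On `X × Γ` an equivariant map to `W` has the form `(x, g) ↦ g • F₀ x`,
with `F₀ (T x) = w x • F₀ x`, so the question is whether `F₀` is a function of the future
`Z = (w_n)_{n ≥ 0}` when its image in `V` is
(`exists_factorization_of_isometric_extension`). Let `κ` be the conditional law of `F₀` given `Z`.
Given the longer future `Z ∘ T⁻ⁿ`, the conditional law of `F₀` is at `x` the translate of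
`κ (Z (T⁻ⁿ x))` by `w_n (T⁻ⁿ x)`, and the translation is isometric on the fibres. By martingale
convergence these laws concentrate near `F₀ x` as `n` grows, while the distribution of their
concentration does not depend on `n`, because `T` preserves the measure. So `κ` is a Dirac measure.
Separability of the fibres is used to know that `F₀ x` is in the support of `κ (Z x)`, so that it
can be approximated by sections sampled from `κ` itself. The past is the future of the reversed Greg
(`Greg.reverse`).
-/

/-! ### Spaces of ergodic components -/

namespace ErgodicComponents

variable {Γ Ω E : Type*} [MeasurableSpace Γ] [MeasurableSpace Ω] {μ : Measure Ω} {S : Ω → Ω}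
  {ρ : Γ → Ω → Ω} [MeasurableSpace E] [StandardBorelSpace E]

theorem measurable_act_const (P : ErgodicComponents μ S ρ E) (g : Γ) : Measurable (P.act g) :=
  P.measurable_act.comp measurable_prodMk_left

theorem factor_comp_ae_eq (P : ErgodicComponents μ S ρ E) :
    ∀ᵐ x ∂μ, P.factor (S x) = P.factor x := by
  have hA : ∀ n, MeasurableSet {e : E | MeasurableSpace.mapNatBool E e n = true} := fun n =>
    ((measurable_pi_apply n).comp (MeasurableSpace.measurable_mapNatBool E))
      (measurableSet_singleton true)
  have h : ∀ᵐ x ∂μ, ∀ n, (MeasurableSpace.mapNatBool E (P.factor (S x)) n = true ↔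
      MeasurableSpace.mapNatBool E (P.factor x) n = true) := by
    rw [ae_all_iff]
    intro n
    have := (P.invariant_iff _ (P.measurable_factor (hA n))).2 ⟨_, hA n, by rfl⟩
    filter_upwards [this] with x hx
    exact iff_of_eq hx
  filter_upwards [h] with x hx
  exact MeasurableSpace.injective_mapNatBool E (funext fun n => Bool.eq_iff_iff.2 (hx n))

theorem ae_measure_iff (P : ErgodicComponents μ S ρ E) {p : E → Prop}
    (hp : MeasurableSet {e | p e}) : (∀ᵐ e ∂P.measure, p e) ↔ ∀ᵐ x ∂μ, p (P.factor x) :=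
  ae_map_iff P.measurable_factor.aemeasurable hp

/-- An almost everywhere equivariant map on `Ω` that factors through the ergodic components
descends to a `Γ`-map. -/
theorem isGammaMap_of_comp_factor (P : ErgodicComponents μ S ρ E)
    (hρ : ∀ g, Measure.QuasiMeasurePreserving (ρ g) μ μ)
    {F : Type*} [MeasurableSpace F] [StandardBorelSpace F] {b : Γ → F → F}
    (hb : ∀ g, Measurable (b g)) {φ : E → F} (hφ : Measurable φ) {f : Ω → F}
    (hφf : ∀ᵐ x ∂μ, φ (P.factor x) = f x) (hf : ∀ g, ∀ᵐ x ∂μ, f (ρ g x) = b g (f x)) :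
    IsGammaMap P.act P.measure b φ := by
  refine ⟨hφ, fun g => ?_⟩
  refine (P.ae_measure_iff (measurableSet_eq_fun (hφ.comp (P.measurable_act_const g))
    ((hb g).comp hφ))).2 ?_
  filter_upwards [hφf, (hρ g).ae hφf, hf g, P.factor_equivariant g] with x h1 h2 h3 h4
  change φ (P.act g (P.factor x)) = b g (φ (P.factor x))
  rw [← h4, h2, h3, h1]

theorem isNonsingularAction {Γ : Type*} [Group Γ] [MeasurableSpace Γ] {ρ : Γ → Ω → Ω}
    (P : ErgodicComponents μ S ρ E)
    (hρ : ∀ g, Measure.QuasiMeasurePreserving (ρ g) μ μ) (h1 : ∀ x, ρ 1 x = x)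
    (hmul : ∀ g h x, ρ (g * h) x = ρ g (ρ h x)) : IsNonsingularAction P.act P.measure where
  measurable := P.measurable_act
  one := by
    refine (P.ae_measure_iff (measurableSet_eq_fun (P.measurable_act_const 1) measurable_id)).2 ?_
    filter_upwards [P.factor_equivariant 1] with x hx
    rw [← hx, h1, id]
  mul g h := by
    refine (P.ae_measure_iff (measurableSet_eq_fun (P.measurable_act_const _)
      ((P.measurable_act_const g).comp (P.measurable_act_const h)))).2 ?_
    filter_upwards [P.factor_equivariant (g * h), P.factor_equivariant h,
      (hρ h).ae (P.factor_equivariant g)] with x hx1 hx2 hx3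
    rw [← hx1, hmul, hx3, hx2, Function.comp_apply]
  map g := by
    have hm : P.measure.map (P.act g) = (μ.map (ρ g)).map P.factor := by
      rw [measure, Measure.map_map (P.measurable_act_const g) P.measurable_factor,
        Measure.map_map P.measurable_factor (hρ g).measurable]
      exact Measure.map_congr ((P.factor_equivariant g).mono fun x hx => hx.symm)
    rw [hm]
    refine ⟨(hρ g).absolutelyContinuous.map P.measurable_factor, ?_⟩
    refine Measure.AbsolutelyContinuous.map ?_ P.measurable_factor
    have h2 := (hρ g⁻¹).absolutelyContinuous.map (hρ g).measurable
    rwa [Measure.map_map (hρ g).measurable (hρ g⁻¹).measurable,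
      show ρ g ∘ ρ g⁻¹ = id from funext fun x => by simp [← hmul, h1], Measure.map_id] at h2

end ErgodicComponents

/-! ### Convergent selections from decreasing convex sets -/

/-- A decreasing sequence of non-empty bounded midpoint-convex subsets of an inner product space
admits a Cauchy selection: elements that almost minimize the norm, by the parallelogram law. -/
theorem exists_cauchySeq_of_antitone_midpoint {H : Type*} [NormedAddCommGroup H]
    [InnerProductSpace ℝ H] {K : ℕ → Set H} (hK : Antitone K) (hne : ∀ n, (K n).Nonempty)
    {C : ℝ} (hC : ∀ x ∈ K 0, ‖x‖ ≤ C)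
    (hmid : ∀ n, ∀ x ∈ K n, ∀ y ∈ K n, (2⁻¹ : ℝ) • (x + y) ∈ K n) :
    ∃ u : ℕ → H, (∀ n, u n ∈ K n) ∧ CauchySeq u := by
  let N : ℕ → Set ℝ := fun n => (fun x => ‖x‖ ^ 2) '' K n
  have hbdd : ∀ n, BddBelow (N n) := fun n => ⟨0, by rintro _ ⟨x, -, rfl⟩; positivity⟩
  have hneN : ∀ n, (N n).Nonempty := fun n => (hne n).image _
  let s : ℕ → ℝ := fun n => sInf (N n)
  have hsm : Monotone s := fun m n hmn =>
    csInf_le_csInf (hbdd m) (hneN n) (image_mono (hK hmn))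
  have hsC : ∀ n, s n ≤ C ^ 2 := fun n => by
    obtain ⟨x, hx⟩ := hne n
    refine (csInf_le (hbdd n) ⟨x, hx, rfl⟩).trans ?_
    exact pow_le_pow_left₀ (norm_nonneg x) (hC x (hK (Nat.zero_le n) hx)) 2
  obtain ⟨l, hl⟩ : ∃ l, Tendsto s atTop (𝓝 l) :=
    ⟨_, tendsto_atTop_ciSup hsm ⟨C ^ 2, by rintro _ ⟨n, rfl⟩; exact hsC n⟩⟩
  have hsl : ∀ n, s n ≤ l := fun n => hsm.ge_of_tendsto hl n
  have hsel : ∀ n : ℕ, ∃ x ∈ K n, ‖x‖ ^ 2 < s n + 1 / ((n : ℝ) + 1) := fun n => by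
    obtain ⟨_, ⟨x, hx, rfl⟩, h⟩ := exists_lt_of_csInf_lt (hneN n)
      (show sInf (N n) < s n + 1 / ((n : ℝ) + 1) by
        have : (0 : ℝ) < 1 / ((n : ℝ) + 1) := by positivity
        change s n < _
        linarith)
    exact ⟨x, hx, h⟩
  choose u huK hu using hsel
  refine ⟨u, huK, ?_⟩
  have key : ∀ n m, n ≤ m → dist (u n) (u m) ^ 2 ≤ 2 * (l - s n) + 4 * (1 / ((n : ℝ) + 1)) := by
    intro n m hnm
    have h1 := parallelogram_law_with_norm ℝ (u n) (u m)
    have h2 : s n ≤ ‖(2⁻¹ : ℝ) • (u n + u m)‖ ^ 2 :=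
      csInf_le (hbdd n) ⟨_, hmid n _ (huK n) _ (hK hnm (huK m)), rfl⟩
    rw [norm_smul, mul_pow] at h2
    norm_num at h2
    have h3 : 1 / ((m : ℝ) + 1) ≤ 1 / ((n : ℝ) + 1) := by gcongr
    rw [dist_eq_norm]
    nlinarith [hu n, hu m, hsl m, hsl n]
  have hlim : Tendsto (fun n : ℕ => √(2 * (l - s n) + 4 * (1 / ((n : ℝ) + 1)))) atTop (𝓝 0) := by
    have h := (((tendsto_const_nhds (x := l)).sub hl).const_mul 2).add
      (tendsto_one_div_add_atTop_nhds_zero_nat.const_mul (4 : ℝ))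
    simpa using h.sqrt
  refine cauchySeq_of_le_tendsto_0' _ (fun n m hnm => ?_) hlim
  exact Real.le_sqrt_of_sq_le (key n m hnm)

/-- A decreasing sequence of non-empty midpoint-convex families of measurable maps to the Hilbert
cube admits a selection with an almost everywhere convergent subsequence: the families embed
into the Hilbert space `L²(Ω × ℕ)`. -/
theorem exists_ae_tendsto_of_antitone_midpoint {Ω : Type*} [MeasurableSpace Ω] {μ : Measure Ω}
    [IsFiniteMeasure μ] {K : ℕ → Set (Ω → ℕ → ℝ)} (hK : Antitone K) (hne : ∀ n, (K n).Nonempty)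
    (hmeas : ∀ f ∈ K 0, Measurable f) (hIcc : ∀ f ∈ K 0, ∀ x, f x ∈ Icc (0 : ℕ → ℝ) 1)
    (hmid : ∀ n, ∀ f ∈ K n, ∀ f' ∈ K n, (2⁻¹ : ℝ) • (f + f') ∈ K n) :
    ∃ (u : ℕ → Ω → ℕ → ℝ) (f : Ω → ℕ → ℝ), (∀ n, u n ∈ K n) ∧ Measurable f ∧
      ∀ᵐ x ∂μ, Tendsto (fun n => u n x) atTop (𝓝 (f x)) := by
  -- A finite measure on the coordinates that charges each of them.
  let κ : Measure ℕ := (Measure.count : Measure ℕ).toFinite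
  have hκ : Measure.count ≪ κ := absolutelyContinuous_toFinite _
  let c : (Ω → ℕ → ℝ) → Ω × ℕ → ℝ := fun f p => f p.1 p.2
  have hK0 : ∀ n, K n ⊆ K 0 := fun n => hK (Nat.zero_le n)
  have hc : ∀ f : Ω → ℕ → ℝ, Measurable f → Measurable (c f) := fun f hf =>
    measurable_from_prod_countable_left fun i => (measurable_pi_apply i).comp hf
  have hbound : ∀ f ∈ K 0, ∀ p, ‖c f p‖ ≤ 1 := fun f hf p => by
    have h := hIcc f hf p.1
    rw [Real.norm_eq_abs, abs_le]
    have h0 : (0 : ℝ) ≤ f p.1 p.2 := h.1 p.2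
    exact ⟨by linarith, h.2 p.2⟩
  have hLp : ∀ f ∈ K 0, MemLp (c f) 2 (μ.prod κ) := fun f hf =>
    MemLp.of_bound (hc f (hmeas f hf)).aestronglyMeasurable 1 (ae_of_all _ (hbound f hf))
  let L : ℕ → Set (Lp ℝ 2 (μ.prod κ)) := fun n => {y | ∃ f ∈ K n, y =ᵐ[μ.prod κ] c f}
  obtain ⟨y, hyL, hy⟩ := exists_cauchySeq_of_antitone_midpoint (K := L)
    (C := (μ.prod κ).real univ ^ (2 : ℝ≥0∞).toReal⁻¹ * 1)
    (fun m n hmn y ⟨f, hf, h⟩ => ⟨f, hK hmn hf, h⟩)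
    (fun n => by
      obtain ⟨f, hf⟩ := hne n
      exact ⟨(hLp f (hK0 n hf)).toLp, f, hf, MemLp.coeFn_toLp _⟩)
    (fun y ⟨f, hf, h⟩ => by
      refine Lp.norm_le_of_ae_bound zero_le_one ?_
      filter_upwards [h] with p hp
      rw [hp]
      exact hbound f hf p)
    (fun n y ⟨f, hf, h⟩ y' ⟨f', hf', h'⟩ => by
      refine ⟨_, hmid n f hf f' hf', ?_⟩
      filter_upwards [Lp.coeFn_smul (2⁻¹ : ℝ) (y + y'), Lp.coeFn_add y y', h, h']
        with p h1 h2 h3 h4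
      rw [h1, Pi.smul_apply, h2, Pi.add_apply, h3, h4]
      rfl)
  obtain ⟨z, hz⟩ := cauchySeq_tendsto_of_complete hy
  obtain ⟨ns, hns, hlim⟩ := (tendstoInMeasure_of_tendsto_Lp hz).exists_seq_tendsto_ae
  choose u huK hu using hyL
  have hlim2 : ∀ᵐ p ∂(μ.prod κ), Tendsto (fun n => c (u (ns n)) p) atTop (𝓝 (z p)) := by
    filter_upwards [hlim, ae_all_iff.2 hu] with p h1 h2
    simpa only [h2] using h1
  have hzm : Measurable (z : Ω × ℕ → ℝ) := (Lp.stronglyMeasurable z).measurable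
  refine ⟨fun n => u (ns n), fun x i => z (x, i), fun n => hK (hns.le_apply) (huK _),
    measurable_pi_lambda _ fun i => hzm.comp (measurable_id.prodMk measurable_const), ?_⟩
  filter_upwards [Measure.ae_ae_of_ae_prod hlim2] with x hx
  rw [tendsto_pi_nhds]
  have h := ae_iff.1 (hκ.ae_le hx)
  rw [Measure.count_eq_zero_iff] at h
  exact fun i => by_contra fun hi => (Set.ext_iff.1 h i).1 hi

/-! ### Amenability of the space of ergodic components -/

section Amenable

variable {Γ Ω : Type*} [Group Γ] [TopologicalSpace Γ] [MeasurableSpace Γ] [BorelSpace Γ]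
  [MeasurableSpace Ω]

/-- Measurable, everywhere equivariant maps `Ω → Q` whose coordinates vary by at most `1 / (n + 1)`
under `S`. -/
def almostInvariantMaps (S : Ω → Ω) (ρ : Γ → Ω → Ω) (Q : Set (ℕ → ℝ)) [MulAction Γ Q] (n : ℕ) :
    Set (Ω → ℕ → ℝ) :=
  {f | Measurable f ∧ (∃ hQ : ∀ x, f x ∈ Q, ∀ g x, (⟨f (ρ g x), hQ _⟩ : Q) = g • ⟨f x, hQ x⟩) ∧
    ∀ x i, |f (S x) i - f x i| ≤ 1 / ((n : ℝ) + 1)}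

/-- The averages of `x ↦ c (S^k x) • q` over `k ≤ n` are equivariant and almost invariant. -/
theorem almostInvariantMaps_nonempty {S : Ω → Ω} (hS : Measurable S) {ρ : Γ → Ω → Ω}
    (hcomm : ∀ g x, ρ g (S x) = S (ρ g x)) {c : Ω → Γ} (hc : Measurable c)
    (hcρ : ∀ g x, c (ρ g x) = g * c x) {Q : Set (ℕ → ℝ)} (hQ01 : Q ⊆ Icc 0 1)
    (hconv : Convex ℝ Q) (hne : Q.Nonempty) [MulAction Γ Q] [ContinuousSMul Γ Q]
    (haff : ∀ (g : Γ) (x y z : Q) (s t : ℝ), 0 ≤ s → 0 ≤ t → s + t = 1 →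
        (z : ℕ → ℝ) = s • (x : ℕ → ℝ) + t • (y : ℕ → ℝ) →
        ((g • z : Q) : ℕ → ℝ) = s • ((g • x : Q) : ℕ → ℝ) + t • ((g • y : Q) : ℕ → ℝ)) (n : ℕ) :
    (almostInvariantMaps S ρ Q n).Nonempty := by
  obtain ⟨q, hq⟩ := hne
  let o : ℕ → Ω → Q := fun k x => c (S^[k] x) • ⟨q, hq⟩
  have hom : ∀ k, Measurable (o k) := fun k => by
    have hcont : Continuous fun g : Γ => g • (⟨q, hq⟩ : Q) := continuous_id.smul continuous_const
    exact hcont.measurable.comp (hc.comp (hS.iterate k))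
  have hoρ : ∀ k g x, o k (ρ g x) = g • o k x := fun k g x => by
    have h : S^[k] (ρ g x) = ρ g (S^[k] x) :=
      ((Function.Commute.iterate_left (f := S) (g := ρ g) (fun x => (hcomm g x).symm) k) x)
    simp only [o, h, hcρ, mul_smul]
  have havg : ∀ n : ℕ, ∃ f : Ω → Q, Measurable f ∧ (∀ g x, f (ρ g x) = g • f x) ∧
      ∀ x, ((n : ℝ) + 1) • (f x : ℕ → ℝ) = ∑ k ∈ Finset.range (n + 1), (o k x : ℕ → ℝ) := by
    intro n
    induction n with
    | zero => exact ⟨o 0, hom 0, hoρ 0, fun x => by simp⟩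
    | succ n ih =>
      obtain ⟨f, hfm, hfρ, hf⟩ := ih
      let s : ℝ := ((n : ℝ) + 1) / ((n : ℝ) + 2)
      let t : ℝ := 1 / ((n : ℝ) + 2)
      have hs : 0 ≤ s := by positivity
      have ht : 0 ≤ t := by positivity
      have hn2 : (n : ℝ) + 2 ≠ 0 := by positivity
      have hst : s + t = 1 := by simp only [s, t]; field_simp; ring
      refine ⟨fun x => ⟨s • (f x : ℕ → ℝ) + t • (o (n + 1) x : ℕ → ℝ),
        hconv (f x).2 (o (n + 1) x).2 hs ht hst⟩, ?_, fun g x => ?_, fun x => ?_⟩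
      · exact Measurable.subtype_mk (((measurable_subtype_coe.comp hfm).const_smul s).add
          ((measurable_subtype_coe.comp (hom (n + 1))).const_smul t))
      · refine Subtype.ext ?_
        rw [haff g (f x) (o (n + 1) x) _ s t hs ht hst rfl]
        simp only [hfρ, hoρ]
      · rw [Finset.sum_range_succ, ← hf, smul_add, smul_smul, smul_smul]
        push_cast
        congr 2
        · simp only [s]; field_simp; ring
        · rw [show ((n : ℝ) + 1 + 1) * t = 1 by simp only [t]; field_simp; ring, one_smul]
  obtain ⟨f, hfm, hfρ, hf⟩ := havg n
  refine ⟨fun x => f x, measurable_subtype_coe.comp hfm, ⟨fun x => (f x).2, fun g x => hfρ g x⟩,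
    fun x i => ?_⟩
  have h1 := congrFun (hf x) i
  have h2 := congrFun (hf (S x)) i
  have h3 : ∀ k, o k (S x) = o (k + 1) x := fun k => rfl
  simp only [h3, Finset.sum_apply, Pi.smul_apply, smul_eq_mul] at h1 h2
  have h4 := Finset.sum_range_succ' (fun k => (o k x : ℕ → ℝ) i) (n + 1)
  rw [Finset.sum_range_succ] at h4
  have b0 := hQ01 (o 0 x).2
  have b1 := hQ01 (o (n + 1) x).2
  have b00 : (0 : ℝ) ≤ (o 0 x : ℕ → ℝ) i := b0.1 i
  have b01 : (o 0 x : ℕ → ℝ) i ≤ (1 : ℝ) := b0.2 i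
  have b10 : (0 : ℝ) ≤ (o (n + 1) x : ℕ → ℝ) i := b1.1 i
  have b11 : (o (n + 1) x : ℕ → ℝ) i ≤ (1 : ℝ) := b1.2 i
  have hpos : (0 : ℝ) < (n : ℝ) + 1 := by positivity
  change |(f (S x) : ℕ → ℝ) i - (f x : ℕ → ℝ) i| ≤ _
  rw [abs_le, ← neg_div, le_div_iff₀ hpos, div_le_iff₀ hpos]
  constructor <;> linarith

variable [StandardBorelSpace Ω] {μ : Measure Ω} [IsProbabilityMeasure μ]

/-- If `Γ` acts on `Ω` with an equivariant map `c : Ω → Γ` (so that the action is induced from the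
trivial group), the action on the space of ergodic components is amenable: limits of convex
combinations of the averages of `c (S^k x) • q` give invariant equivariant maps to `Q`. -/
theorem ErgodicComponents.isZimmerAmenable {S : Ω → Ω}
    (hS : Measure.QuasiMeasurePreserving S μ μ) {ρ : Γ → Ω → Ω}
    (hρ : ∀ g, Measure.QuasiMeasurePreserving (ρ g) μ μ)
    (hcomm : ∀ g x, ρ g (S x) = S (ρ g x)) {c : Ω → Γ} (hc : Measurable c)
    (hcρ : ∀ g x, c (ρ g x) = g * c x) {E : Type*} [MeasurableSpace E] [StandardBorelSpace E]
    (P : ErgodicComponents μ S ρ E) : IsZimmerAmenable P.act P.measure := by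
  classical
  intro Q hQ01 hQc hQconv hQne _ _ haff
  have : StandardBorelSpace Q := hQc.measurableSet.standardBorel
  obtain ⟨u, f, hu, hfm, hlim⟩ := exists_ae_tendsto_of_antitone_midpoint (μ := μ)
    (K := almostInvariantMaps S ρ Q)
    (fun m n hmn f ⟨h1, h2, h3⟩ => ⟨h1, h2, fun x i => (h3 x i).trans (by gcongr)⟩)
    (almostInvariantMaps_nonempty hS.measurable hcomm hc hcρ hQ01 hQconv hQne haff)
    (fun f hf => hf.1) (fun f hf x => hQ01 (hf.2.1.1 x))
    (by
      rintro n f ⟨h1, ⟨h2, h3⟩, h4⟩ f' ⟨h1', ⟨h2', h3'⟩, h4'⟩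
      have hhalf : ∀ x, (2⁻¹ : ℝ) • (f x + f' x) ∈ Q := fun x => by
        rw [smul_add]
        exact hQconv (h2 x) (h2' x) (by norm_num) (by norm_num) (by norm_num)
      refine ⟨(h1.add h1').const_smul (2⁻¹ : ℝ), ⟨hhalf, fun g x => Subtype.ext ?_⟩,
        fun x i => ?_⟩
      · have h := haff g ⟨f x, h2 x⟩ ⟨f' x, h2' x⟩ ⟨_, hhalf x⟩ 2⁻¹ 2⁻¹ (by norm_num)
          (by norm_num) (by norm_num) (smul_add _ _ _)
        rw [← h3, ← h3'] at h
        exact (smul_add _ _ _).trans h.symm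
      · have e1 := abs_le.1 (h4 x i)
        have e2 := abs_le.1 (h4' x i)
        change |2⁻¹ * (f (S x) i + f' (S x) i) - 2⁻¹ * (f x i + f' x i)| ≤ _
        rw [abs_le]
        constructor <;> linarith)
  obtain ⟨q, hq⟩ := hQne
  let v : ℕ → Ω → Q := fun n x => ⟨u n x, (hu n).2.1.1 x⟩
  -- Off the null set where the limit leaves `Q`, its value is irrelevant.
  let ψ : Ω → Q := fun x => if h : f x ∈ Q then ⟨f x, h⟩ else ⟨q, hq⟩
  have hψm : Measurable ψ := by
    have : ψ = fun x => ⟨(f ⁻¹' Q).piecewise f (fun _ => q) x, by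
        by_cases h : f x ∈ Q <;> simp [Set.piecewise, h, hq]⟩ := by
      funext x
      by_cases h : f x ∈ Q <;> simp [ψ, Set.piecewise, h]
    rw [this]
    exact Measurable.subtype_mk (hfm.piecewise (hfm hQc.measurableSet) measurable_const)
  have hψ : ∀ᵐ x ∂μ, Tendsto (fun n => v n x) atTop (𝓝 (ψ x)) := by
    filter_upwards [hlim] with x hx
    have hxQ : f x ∈ Q := hQc.mem_of_tendsto hx (Eventually.of_forall fun n => (hu n).2.1.1 x)
    simp only [ψ, dif_pos hxQ]
    exact tendsto_subtype_rng.2 hx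
  have hψρ : ∀ g, ∀ᵐ x ∂μ, ψ (ρ g x) = g • ψ x := by
    intro g
    filter_upwards [hψ, (hρ g).ae hψ] with x h1 h2
    refine tendsto_nhds_unique h2 ?_
    have h3 : ∀ n, v n (ρ g x) = g • v n x := fun n => (hu n).2.1.2 g x
    simp only [h3]
    exact h1.const_smul g
  have hψS : ∀ᵐ x ∂μ, ψ (S x) = ψ x := by
    filter_upwards [hψ, hS.ae hψ] with x h1 h2
    refine Subtype.ext (funext fun i => ?_)
    have e1 := tendsto_pi_nhds.1 (tendsto_subtype_rng.1 h1) i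
    have e2 := tendsto_pi_nhds.1 (tendsto_subtype_rng.1 h2) i
    have e3 : Tendsto (fun n => (v n (S x) : ℕ → ℝ) i - (v n x : ℕ → ℝ) i) atTop (𝓝 0) :=
      squeeze_zero_norm (fun n => (hu n).2.2 x i) tendsto_one_div_add_atTop_nhds_zero_nat
    exact sub_eq_zero.1 (tendsto_nhds_unique (e2.sub e1) e3)
  obtain ⟨π, hπ, hπψ⟩ := P.exists_factorization ψ hψm hψS
  exact ⟨π, P.isGammaMap_of_comp_factor hρ (fun g => (continuous_const_smul g).measurable)
    hπ hπψ hψρ⟩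

end Amenable

/-! ### Cocycle extensions over a factor of a measure preserving transformation -/

section Contraction

open ProbabilityTheory unitInterval

variable {X 𝒵 : Type*} [mX : MeasurableSpace X] [MeasurableSpace 𝒵] {m : Measure X}
  [IsProbabilityMeasure m] {θ : X ≃ᵐ X} {Z : X → 𝒵} {R : 𝒵 → 𝒵}

/-- The increasing `σ`-algebras generated by `Z ∘ θ⁻ⁿ`, where `Z` intertwines `θ` with a
(non-invertible) map `R`. -/
def backwardFiltration (θ : X ≃ᵐ X) (hZ : Measurable Z) (hR : Measurable R)
    (hZR : ∀ x, Z (θ x) = R (Z x)) : Filtration ℕ mX where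
  seq n := MeasurableSpace.comap (fun x => Z (θ.symm^[n] x)) inferInstance
  mono' := by
    refine monotone_nat_of_le_succ fun n => ?_
    have h : (fun x => Z (θ.symm^[n] x)) = R ∘ fun x => Z (θ.symm^[n + 1] x) := by
      funext x
      rw [Function.comp_apply, ← hZR, Function.iterate_succ_apply', θ.apply_symm_apply]
    rw [h, ← MeasurableSpace.comap_comp]
    exact MeasurableSpace.comap_mono hR.comap_le
  le' n := (hZ.comp (θ.symm.measurable.iterate n)).comap_le

theorem symm_iterate_iterate (θ : X ≃ᵐ X) (n : ℕ) (x : X) : θ.symm^[n] (θ^[n] x) = x :=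
  Function.LeftInverse.iterate (fun y => θ.symm_apply_apply y) n x

omit [IsProbabilityMeasure m] in
/-- Up to a factor `2`, the conditional expectation is a best approximation in `L¹`. -/
theorem eLpNorm_condExp_sub_le [IsFiniteMeasure m] {𝓖 : MeasurableSpace X} (h𝓖 : 𝓖 ≤ mX)
    {g h : X → ℝ} (hg : Integrable g m) (hh : Integrable h m) (hm : StronglyMeasurable[𝓖] h) :
    eLpNorm (m[g | 𝓖] - g) 1 m ≤ 2 * eLpNorm (h - g) 1 m := by
  have e2 : m[g | 𝓖] - h =ᵐ[m] m[g - h | 𝓖] := by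
    have := condExp_sub hg hh 𝓖
    rw [condExp_of_stronglyMeasurable h𝓖 hm hh] at this
    exact this.symm
  have e3 : eLpNorm (m[g | 𝓖] - h) 1 m ≤ eLpNorm (h - g) 1 m := by
    rw [eLpNorm_congr_ae e2, eLpNorm_sub_comm h g]
    exact eLpNorm_condExp_le_eLpNorm _ le_rfl
  calc _ = eLpNorm ((m[g | 𝓖] - h) + (h - g)) 1 m := by rw [sub_add_sub_cancel]
    _ ≤ _ := eLpNorm_add_le (integrable_condExp.sub hh).aestronglyMeasurable
        (hh.sub hg).aestronglyMeasurable le_rfl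
    _ ≤ _ := by rw [two_mul]; gcongr

/-- Upward martingale convergence along `backwardFiltration`, moved to a fixed `σ`-algebra by the
invariance of the measure: `f ∘ θ^[n]` is asymptotically a function of `Z`. -/
theorem tendsto_eLpNorm_condExp_iterate_sub (hθ : MeasurePreserving θ m m) (hZ : Measurable Z)
    (hR : Measurable R) (hZR : ∀ x, Z (θ x) = R (Z x)) {f : X → ℝ} (hfi : Integrable f m)
    (hf : StronglyMeasurable[⨆ n, backwardFiltration θ hZ hR hZR n] f) :
    Tendsto (fun n => eLpNorm (m[f ∘ θ^[n] | MeasurableSpace.comap Z inferInstance] -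
      f ∘ θ^[n]) 1 m) atTop (𝓝 0) := by
  have h1 : Tendsto (fun n => 2 * eLpNorm (m[f | backwardFiltration θ hZ hR hZR n] - f) 1 m)
      atTop (𝓝 0) := by
    have := ENNReal.Tendsto.const_mul (a := 2) (hfi.tendsto_eLpNorm_condExp hf) (Or.inr (by simp))
    rwa [mul_zero] at this
  refine tendsto_of_tendsto_of_tendsto_of_le_of_le tendsto_const_nhds h1 (fun n => zero_le)
    fun n => ?_
  have hθn : MeasurePreserving θ^[n] m m := hθ.iterate n
  have hm : Measurable[MeasurableSpace.comap Z inferInstance, backwardFiltration θ hZ hR hZR n]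
      θ^[n] := by
    refine measurable_comap_iff.2 ?_
    simpa only [Function.comp_def, symm_iterate_iterate] using comap_measurable Z
  have hhm : StronglyMeasurable[MeasurableSpace.comap Z inferInstance]
      (m[f | backwardFiltration θ hZ hR hZR n] ∘ θ^[n]) :=
    stronglyMeasurable_condExp.comp_measurable hm
  have hhi : Integrable (m[f | backwardFiltration θ hZ hR hZR n]) m := integrable_condExp
  have e1 := eLpNorm_comp_measurePreserving (p := 1) (hhi.sub hfi).aestronglyMeasurable hθn
  rw [← e1]
  exact eLpNorm_condExp_sub_le hZ.comap_le (hθn.integrable_comp_of_integrable hfi)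
    (hθn.integrable_comp_of_integrable hhi) hhm

theorem measurable_kernel_apply_rel {W : Type*} [MeasurableSpace W] (κ : Kernel 𝒵 W)
    [IsSFiniteKernel κ] {r : W → W → Prop} (hr : MeasurableSet {p : W × W | r p.1 p.2}) :
    Measurable fun p : 𝒵 × W => κ p.1 {w | r w p.2} :=
  Kernel.measurable_kernel_prodMk_left (κ := κ.comap (Prod.fst : 𝒵 × W → 𝒵) measurable_fst)
    (t := {q : (𝒵 × W) × W | r q.2 q.1.2})
    ((measurable_snd.prodMk (measurable_snd.comp measurable_fst)) hr)

/-- If `ρ` is positive almost everywhere, then, uniformly in `n`, `ρ ∘ θ^[n]` is bounded below off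
a set of small measure, so `a` has to vanish. -/
theorem ae_eq_zero_of_tendsto_lintegral_iterate_mul (hθ : MeasurePreserving θ m m)
    {ρ a : X → ℝ≥0∞} (hρ : Measurable ρ) (ha : Measurable a) (ha1 : ∀ x, a x ≤ 1)
    (hρ0 : ∀ᵐ x ∂m, ρ x ≠ 0)
    (hlim : Tendsto (fun n => ∫⁻ x, ρ (θ^[n] x) * a x ∂m) atTop (𝓝 0)) : ∀ᵐ x ∂m, a x = 0 := by
  let D : ℕ → Set X := fun k => {x | (k : ℝ≥0∞) * ρ x < 1}
  have hD : ∀ k, MeasurableSet (D k) := fun k =>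
    measurableSet_lt (hρ.const_mul _) measurable_const
  have hle : ∀ k, ∫⁻ x, a x ∂m ≤ m (D k) := by
    intro k
    have hk : ∀ n, ∫⁻ x, a x ∂m ≤ k * ∫⁻ x, ρ (θ^[n] x) * a x ∂m + m (D k) := by
      intro n
      have hθn : MeasurePreserving θ^[n] m m := hθ.iterate n
      rw [← lintegral_const_mul _ (f := fun x => ρ (θ^[n] x) * a x)
          ((hρ.comp hθn.measurable).mul ha),
        ← hθn.measure_preimage (hD k).nullMeasurableSet,
        ← lintegral_indicator_one (hθn.measurable (hD k)),
        ← lintegral_add_right _ (measurable_one.indicator (hθn.measurable (hD k)))]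
      refine lintegral_mono fun x => ?_
      by_cases hx : θ^[n] x ∈ D k
      · have : (θ^[n] ⁻¹' D k).indicator (1 : X → ℝ≥0∞) x = 1 :=
          indicator_of_mem (mem_preimage.2 hx) _
        rw [this]
        exact (ha1 x).trans le_add_self
      · have h1 : 1 ≤ (k : ℝ≥0∞) * ρ (θ^[n] x) := not_lt.1 hx
        calc a x = 1 * a x := (one_mul _).symm
          _ ≤ (k * ρ (θ^[n] x)) * a x := by gcongr
          _ = k * (ρ (θ^[n] x) * a x) := mul_assoc _ _ _
          _ ≤ _ := le_self_add
    have h2 : Tendsto (fun n => (k : ℝ≥0∞) * ∫⁻ x, ρ (θ^[n] x) * a x ∂m + m (D k)) atTop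
        (𝓝 (k * 0 + m (D k))) :=
      (ENNReal.Tendsto.const_mul hlim (Or.inr (ENNReal.natCast_ne_top k))).add tendsto_const_nhds
    rw [mul_zero, zero_add] at h2
    exact ge_of_tendsto' h2 hk
  have hDanti : Antitone D := fun k l hkl x hx =>
    lt_of_le_of_lt (by gcongr) (show (l : ℝ≥0∞) * ρ x < 1 from hx)
  have hDlim := tendsto_measure_iInter_atTop (μ := m) (fun k => (hD k).nullMeasurableSet) hDanti
    ⟨0, measure_ne_top _ _⟩
  have hDnull : m (⋂ k, D k) = 0 := by
    refine measure_mono_null (fun x hx => ?_) hρ0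
    simp only [mem_compl_iff, mem_ofPred_eq, not_not]
    by_contra h0
    obtain ⟨k, hk⟩ := ENNReal.exists_nat_mul_gt h0 ENNReal.one_ne_top
    exact lt_asymm hk (mem_iInter.1 hx k)
  rw [hDnull] at hDlim
  have hint : ∫⁻ x, a x ∂m = 0 := le_antisymm (ge_of_tendsto' hDlim hle) zero_le
  exact (lintegral_eq_zero_iff ha).1 hint

omit [IsProbabilityMeasure m] in
theorem exists_iterate_smul {Γ W : Type*} [Group Γ] [MeasurableSpace Γ] [MeasurableMul₂ Γ]
    [MulAction Γ W] {F : X → W} {c : 𝒵 → Γ} (hθ : MeasurePreserving θ m m)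
    (hR : Measurable R) (hZR : ∀ x, Z (θ x) = R (Z x)) (hc : Measurable c)
    (hF : ∀ᵐ x ∂m, F (θ x) = c (Z x) • F x) (n : ℕ) :
    ∃ cn : 𝒵 → Γ, Measurable cn ∧ ∀ᵐ x ∂m, F (θ^[n] x) = cn (Z x) • F x := by
  induction n with
  | zero => exact ⟨fun _ => 1, measurable_const, by simp⟩
  | succ n ih =>
    obtain ⟨cn, hcn, h⟩ := ih
    refine ⟨fun z => cn (R z) * c z, (hcn.comp hR).mul hc, ?_⟩
    filter_upwards [hF, hθ.quasiMeasurePreserving.ae h] with x h1 h2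
    rw [Function.iterate_succ_apply, h2, h1, hZR, mul_smul]

variable {Γ W : Type*} [Group Γ] [MeasurableSpace Γ] [MeasurableSpace W] [StandardBorelSpace W]
  [MulAction Γ W] [MeasurableSMul₂ Γ W] {d : W → W → ℝ≥0∞} {F : X → W} {c : 𝒵 → Γ} [Nonempty W]

/-- If `F (θ^[n] x)` is close to `s (Z (θ^[n] x))` for a fixed measurable section `s`, then, by martingale
convergence and equivariance, the conditional law of `F` given `Z` at `x` is concentrated near
`F x`. -/
theorem tendsto_lintegral_indicator_mul_condDistrib (hθ : MeasurePreserving θ m m)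
    (hZ : Measurable Z) (hR : Measurable R) (hZR : ∀ x, Z (θ x) = R (Z x)) [MeasurableMul₂ Γ]
    (hc : Measurable c) (hFm : Measurable F)
    (hFZ : Measurable[⨆ n, backwardFiltration θ hZ hR hZR n] F)
    (hF : ∀ᵐ x ∂m, F (θ x) = c (Z x) • F x)
    (hd : Measurable fun p : W × W => d p.1 p.2) (hcomm : ∀ x y, d x y = d y x)
    (htri : ∀ x y z, d x z ≤ d x y + d y z) (hinv : ∀ (g : Γ) x y, d (g • x) (g • y) = d x y)
    {s : 𝒵 → W} (hs : Measurable s) (ε : ℝ≥0∞) :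
    Tendsto (fun n => ∫⁻ x, {y | d (F y) (s (Z y)) < ε}.indicator 1 (θ^[n] x) *
      condDistrib F Z m (Z x) {w | ¬ d w (F x) < ε + ε} ∂m) atTop (𝓝 0) := by
  set 𝓕 := backwardFiltration θ hZ hR hZR with h𝓕
  set A : Set X := {y | d (F y) (s (Z y)) < ε} with hA
  have hZ0 : Measurable[⨆ n, 𝓕 n] Z := by
    have h0 : Measurable[𝓕 0] Z := comap_measurable Z
    exact h0.mono (le_iSup (fun n => 𝓕 n) 0) le_rfl
  have hAm : MeasurableSet[⨆ n, 𝓕 n] A :=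
    (hd.comp (Measurable.prodMk hFZ (hs.comp hZ0))) measurableSet_Iio
  have hAm' : MeasurableSet A :=
    (hd.comp (hFm.prodMk (hs.comp hZ))) measurableSet_Iio
  let f : X → ℝ := A.indicator 1
  have hfi : Integrable f m := (integrable_const (1 : ℝ)).indicator hAm'
  have hlim := tendsto_eLpNorm_condExp_iterate_sub hθ hZ hR hZR hfi
    (stronglyMeasurable_one.indicator hAm)
  simp only [eLpNorm_one_eq_lintegral_enorm] at hlim
  refine tendsto_of_tendsto_of_tendsto_of_le_of_le tendsto_const_nhds hlim (fun n => zero_le)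
    fun n => lintegral_mono_ae ?_
  -- By equivariance, `θ^[n] x ∈ A` says that `F x` is in an `ε`-ball whose centre depends on `Z x`.
  obtain ⟨cn, hcn, hcnF⟩ := exists_iterate_smul hθ hR hZR hc hF n
  let D : Set (𝒵 × W) := {p | d (cn p.1 • p.2) (s (R^[n] p.1)) < ε}
  have hD : MeasurableSet D := by
    refine hd.comp (Measurable.prodMk ?_ ?_) measurableSet_Iio
    · exact (hcn.comp measurable_fst).smul measurable_snd
    · exact hs.comp ((hR.iterate n).comp measurable_fst)
  have hZn : ∀ x, Z (θ^[n] x) = R^[n] (Z x) := fun x =>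
    (Function.Semiconj.iterate_right (f := Z) (ga := θ) (gb := R) hZR n) x
  have hfD : f ∘ θ^[n] =ᵐ[m] fun y => D.indicator (1 : 𝒵 × W → ℝ) (Z y, F y) := by
    filter_upwards [hcnF] with y hy
    have : θ^[n] y ∈ A ↔ (Z y, F y) ∈ D := by
      change d (F (θ^[n] y)) (s (Z (θ^[n] y))) < ε ↔ _
      rw [hy, hZn]
      rfl
    by_cases h : θ^[n] y ∈ A
    · rw [indicator_of_mem (this.1 h)]
      exact indicator_of_mem h _
    · rw [indicator_of_notMem (mt this.2 h)]
      exact indicator_of_notMem h _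
  have hcond : m[f ∘ θ^[n] | MeasurableSpace.comap Z inferInstance] =ᵐ[m]
      fun x => (condDistrib F Z m (Z x)).real (Prod.mk (Z x) ⁻¹' D) := by
    refine (condExp_congr_ae hfD).trans ((condExp_prod_ae_eq_integral_condDistrib hZ
      hFm.aemeasurable (stronglyMeasurable_one.indicator hD) ?_).trans ?_)
    · exact ((hθ.iterate n).integrable_comp_of_integrable hfi).congr hfD
    · filter_upwards with x
      rw [← integral_indicator_one (measurable_prodMk_left hD)]
      rfl
  filter_upwards [hcond, hcnF] with x h1 h2
  by_cases hx : θ^[n] x ∈ A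
  · have hfx : f (θ^[n] x) = 1 := indicator_of_mem hx _
    rw [indicator_of_mem hx, Pi.one_apply, one_mul, Pi.sub_apply, h1, Function.comp_apply, hfx,
      ← neg_sub, enorm_neg,
      ← probReal_compl_eq_one_sub (measurable_prodMk_left hD),
      Real.enorm_of_nonneg measureReal_nonneg, ofReal_measureReal]
    refine measure_mono fun w hw hwD => hw ?_
    have hx' : d (cn (Z x) • F x) (s (R^[n] (Z x))) < ε := by
      rw [← h2, ← hZn]
      exact hx
    calc d w (F x) = d (cn (Z x) • w) (cn (Z x) • F x) := (hinv _ _ _).symm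
      _ ≤ _ := htri _ (s (R^[n] (Z x))) _
      _ < ε + ε := ENNReal.add_lt_add hwD (by rwa [hcomm])
  · rw [indicator_of_notMem hx, zero_mul]
    exact zero_le

/-- The conditional law of `F` given `Z` gives full measure to every ball around `F`: average the
preceding statement over sections sampled from the conditional law itself. -/
theorem ae_condDistrib_compl_ball_eq_zero (hθ : MeasurePreserving θ m m)
    (hZ : Measurable Z) (hR : Measurable R) (hZR : ∀ x, Z (θ x) = R (Z x)) [MeasurableMul₂ Γ]
    (hc : Measurable c) (hFm : Measurable F)
    (hFZ : Measurable[⨆ n, backwardFiltration θ hZ hR hZR n] F)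
    (hF : ∀ᵐ x ∂m, F (θ x) = c (Z x) • F x)
    (hd : Measurable fun p : W × W => d p.1 p.2) (hcomm : ∀ x y, d x y = d y x)
    (htri : ∀ x y z, d x z ≤ d x y + d y z) (hinv : ∀ (g : Γ) x y, d (g • x) (g • y) = d x y)
    (ε : ℝ≥0∞) (hpos : ∀ᵐ x ∂m, condDistrib F Z m (Z x) {w | d w (F x) < ε} ≠ 0) :
    ∀ᵐ x ∂m, condDistrib F Z m (Z x) {w | ¬ d w (F x) < ε + ε} = 0 := by
  obtain ⟨s, hs, hsκ⟩ := (condDistrib F Z m).exists_measurable_map_eq_unitInterval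
  have hst : ∀ z, Measurable (s z) := fun z => hs.comp measurable_prodMk_left
  have hball : ∀ δ : ℝ≥0∞, MeasurableSet {p : W × W | d p.1 p.2 < δ} := fun δ =>
    hd measurableSet_Iio
  have hZF : Measurable fun x => (Z x, F x) := hZ.prodMk hFm
  have hρ := (measurable_kernel_apply_rel (condDistrib F Z m) (r := fun u v => d u v < ε)
    (hball ε)).comp hZF
  have ha := (measurable_kernel_apply_rel (condDistrib F Z m) (r := fun u v => ¬ d u v < ε + ε)
    (hball (ε + ε)).compl).comp hZF
  refine ae_eq_zero_of_tendsto_lintegral_iterate_mul hθ hρ ha (fun x => prob_le_one) hpos ?_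
  let A : I → Set X := fun t => {y | d (F y) (s (Z y) t) < ε}
  have hA2 : MeasurableSet {p : I × X | p.2 ∈ A p.1} :=
    (hd.comp ((hFm.comp measurable_snd).prodMk
      (hs.comp ((hZ.comp measurable_snd).prodMk measurable_fst)))) measurableSet_Iio
  have hlim : Tendsto (fun n => ∫⁻ t : I, ∫⁻ x, (A t).indicator 1 (θ^[n] x) *
      condDistrib F Z m (Z x) {w | ¬ d w (F x) < ε + ε} ∂m) atTop (𝓝 (∫⁻ t : I, 0)) := by
    refine tendsto_lintegral_of_dominated_convergence' 1 (fun n => ?_) (fun n => ?_) (by simp) ?_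
    · refine (Measurable.lintegral_prod_right' (f := fun p : I × X =>
        (A p.1).indicator (1 : X → ℝ≥0∞) (θ^[n] p.2) *
          condDistrib F Z m (Z p.2) {w | ¬ d w (F p.2) < ε + ε}) ?_).aemeasurable
      refine Measurable.mul ?_ (ha.comp measurable_snd)
      exact (measurable_one.indicator hA2).comp
        (measurable_fst.prodMk ((θ.measurable.iterate n).comp measurable_snd))
    · refine ae_of_all _ fun t => ?_
      calc _ ≤ ∫⁻ x, 1 ∂m := lintegral_mono fun x => by
            refine mul_le_one' (indicator_le_self' (fun _ _ => zero_le) _) prob_le_one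
        _ = _ := by simp
    · refine ae_of_all _ fun t => ?_
      exact tendsto_lintegral_indicator_mul_condDistrib hθ hZ hR hZR hc hFm hFZ hF hd hcomm htri
        hinv (hs.comp measurable_prodMk_right) ε
  rw [lintegral_zero] at hlim
  refine hlim.congr fun n => ?_
  rw [lintegral_lintegral_swap]
  · refine lintegral_congr fun x => ?_
    rw [lintegral_mul_const]
    · congr 1
      have hB : MeasurableSet {t | d (F (θ^[n] x)) (s (Z (θ^[n] x)) t) < ε} :=
        (hd.comp (measurable_const.prodMk (hst _))) measurableSet_Iio
      refine (lintegral_indicator_one hB).trans ?_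
      change _ = condDistrib F Z m (Z (θ^[n] x)) {w | d w (F (θ^[n] x)) < ε}
      have hB' : MeasurableSet {w | d w (F (θ^[n] x)) < ε} :=
        (hd.comp (measurable_id.prodMk measurable_const)) measurableSet_Iio
      rw [← hsκ, Measure.map_apply (hst _) hB']
      simp only [hcomm (F (θ^[n] x))]
      rfl
    · exact (measurable_one.indicator hA2).comp (measurable_id.prodMk measurable_const)
  · refine (Measurable.mul ?_ (ha.comp measurable_snd)).aemeasurable
    exact (measurable_one.indicator hA2).comp
      (measurable_fst.prodMk ((θ.measurable.iterate n).comp measurable_snd))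

variable {V : Type*} [MeasurableSpace V] [StandardBorelSpace V] {q : W → V} {f : 𝒵 → V}

/-- Almost every point of a separable fibre is in the support of the conditional law: the null balls
around a countable dense set cover all other points. -/
theorem ae_condDistrib_ball_ne_zero (hZ : Measurable Z) (hFm : Measurable F)
    (hd : Measurable fun p : W × W => d p.1 p.2) (hcomm : ∀ x y, d x y = d y x)
    (htri : ∀ x y z, d x z ≤ d x y + d y z) (hq : Measurable q) (hf : Measurable f)
    (hqF : ∀ᵐ x ∂m, q (F x) = f (Z x))
    (hsep : ∀ v : V, ∃ S : Set W, S.Countable ∧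
      ∀ x, q x = v → ∀ ε : ℝ≥0∞, 0 < ε → ∃ s ∈ S, d x s < ε) {ε : ℝ≥0∞} (hε : 0 < ε) :
    ∀ᵐ x ∂m, condDistrib F Z m (Z x) {w | d w (F x) < ε} ≠ 0 := by
  set κ := condDistrib F Z m
  have hlaw : m.map Z ⊗ₘ κ = m.map fun x => (Z x, F x) :=
    compProd_map_condDistrib hFm.aemeasurable
  have hZF : Measurable fun x => (Z x, F x) := hZ.prodMk hFm
  have hball : MeasurableSet {p : W × W | d p.1 p.2 < ε} := hd measurableSet_Iio
  have hfib : ∀ᵐ z ∂(m.map Z), ∀ᵐ w ∂(κ z), q w = f z := by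
    refine Measure.ae_ae_of_ae_compProd (p := fun p : 𝒵 × W => q p.2 = f p.1) ?_
    rw [hlaw]
    exact (ae_map_iff hZF.aemeasurable (measurableSet_eq_fun (hq.comp measurable_snd)
      (hf.comp measurable_fst))).2 hqF
  have hm : MeasurableSet {p : 𝒵 × W | κ p.1 {w | d w p.2 < ε} ≠ 0} :=
    (measurable_kernel_apply_rel κ (r := fun u v => d u v < ε) hball)
      (measurableSet_singleton 0).compl
  suffices h : ∀ᵐ p ∂(m.map Z ⊗ₘ κ), κ p.1 {w | d w p.2 < ε} ≠ 0 by
    rw [hlaw] at h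
    exact (ae_map_iff hZF.aemeasurable hm).1 h
  refine (Measure.ae_compProd_iff hm).2 ?_
  filter_upwards [hfib] with z hz
  obtain ⟨S, hS, hdense⟩ := hsep (f z)
  have hnull : κ z (⋃ s ∈ {s ∈ S | κ z {w | d w s < ε / 2} = 0}, {w | d w s < ε / 2}) = 0 :=
    (measure_biUnion_null_iff (hS.mono fun _ h => h.1)).2 fun s hs => hs.2
  filter_upwards [hz, measure_eq_zero_iff_ae_notMem.1 hnull] with w hw hw2 h0
  obtain ⟨s, hsS, hs⟩ := hdense w hw (ε / 2) (ENNReal.half_pos hε.ne')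
  refine hw2 (mem_biUnion (x := s) ⟨hsS, measure_mono_null (fun u hu => ?_) h0⟩ hs)
  calc d u w ≤ d u s + d s w := htri _ _ _
    _ < ε / 2 + ε / 2 := ENNReal.add_lt_add hu (by rwa [hcomm])
    _ = ε := ENNReal.add_halves ε

/-- Let `F : X → W` satisfy `F (θ x) = c (Z x) • F x`, and let `q : W → V` have separable fibres for
an invariant extended metric on `W`. If `q ∘ F` is a function of the non-invertible factor `Z`, and
`F` is a function of its natural extension, i.e. of the sequence `Z (θ⁻ⁿ x)`, then `F` is a function
of `Z`: its conditional law given `Z` is a Dirac measure. -/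
theorem exists_factorization_of_isometric_extension (hθ : MeasurePreserving θ m m)
    (hZ : Measurable Z) (hR : Measurable R) (hZR : ∀ x, Z (θ x) = R (Z x)) [MeasurableMul₂ Γ]
    (hc : Measurable c) (hFm : Measurable F)
    (hFZ : Measurable[⨆ n, backwardFiltration θ hZ hR hZR n] F)
    (hF : ∀ᵐ x ∂m, F (θ x) = c (Z x) • F x)
    (hd : Measurable fun p : W × W => d p.1 p.2) (heq : ∀ x y, d x y = 0 → x = y)
    (hcomm : ∀ x y, d x y = d y x)
    (htri : ∀ x y z, d x z ≤ d x y + d y z) (hinv : ∀ (g : Γ) x y, d (g • x) (g • y) = d x y)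
    (hq : Measurable q) (hf : Measurable f) (hqF : ∀ᵐ x ∂m, q (F x) = f (Z x))
    (hsep : ∀ v : V, ∃ S : Set W, S.Countable ∧
      ∀ x, q x = v → ∀ ε : ℝ≥0∞, 0 < ε → ∃ s ∈ S, d x s < ε) :
    ∃ φ : 𝒵 → W, Measurable φ ∧ ∀ᵐ x ∂m, F x = φ (Z x) := by
  obtain ⟨s, hs, hsκ⟩ := (condDistrib F Z m).exists_measurable_map_eq_unitInterval
  have hst : ∀ z, Measurable (s z) := fun z => hs.comp measurable_prodMk_left
  have h1 : ∀ᵐ x ∂m, ∀ k : ℕ, condDistrib F Z m (Z x)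
      {w | ¬ d w (F x) < ((k : ℝ≥0∞) + 1)⁻¹ + ((k : ℝ≥0∞) + 1)⁻¹} = 0 := by
    rw [ae_all_iff]
    intro k
    exact ae_condDistrib_compl_ball_eq_zero hθ hZ hR hZR hc hFm hFZ hF hd hcomm htri hinv _
      (ae_condDistrib_ball_ne_zero hZ hFm hd hcomm htri hq hf hqF hsep
        (ENNReal.inv_pos.2 (by finiteness)))
  have hlim : Tendsto (fun k : ℕ => ((k : ℝ≥0∞) + 1)⁻¹ + ((k : ℝ≥0∞) + 1)⁻¹) atTop (𝓝 0) := by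
    have h := ENNReal.tendsto_inv_nat_nhds_zero.comp (tendsto_add_atTop_nat 1)
    simpa [Function.comp_def] using h.add h
  -- Sampling from a Dirac law recovers `F`, so almost every parameter `t` gives a factorization.
  have h2 : ∀ᵐ x ∂m, ∀ᵐ t : I, s (Z x) t = F x := by
    filter_upwards [h1] with x hx
    have h3 : ∀ᵐ w ∂(condDistrib F Z m (Z x)), w = F x := by
      filter_upwards [ae_all_iff.2 hx] with w hw
      refine heq _ _ (le_antisymm (ge_of_tendsto' hlim fun k => ?_) zero_le)
      exact (show d w (F x) < _ from hw k).le
    rw [← hsκ] at h3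
    exact ae_of_ae_map (hst _).aemeasurable h3
  have hm : MeasurableSet {p : X × I | s (Z p.1) p.2 = F p.1} :=
    measurableSet_eq_fun (hs.comp ((hZ.comp measurable_fst).prodMk measurable_snd))
      (hFm.comp measurable_fst)
  obtain ⟨t, ht⟩ := ((Measure.ae_ae_comm hm).1 h2).exists
  exact ⟨fun z => s z t, hs.comp measurable_prodMk_right, ht.mono fun x hx => hx.symm⟩

end Contraction

/-! ### The fibrewise metric as an extended metric on the total space -/

namespace SeparableMetricExtension

variable {Γ W V : Type*} [Group Γ] [MulAction Γ W] [MulAction Γ V] [MeasurableSpace W]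
  [MeasurableSpace V]

open Classical in
/-- The metric on the fibres of `q`, extended by `∞` to pairs of points in different fibres. -/
noncomputable def extDist (ext : SeparableMetricExtension Γ W V) (x y : W) : ℝ≥0∞ :=
  if ext.q x = ext.q y then ext.d x y else ∞

variable (ext : SeparableMetricExtension Γ W V)

theorem extDist_of_eq {x y : W} (h : ext.q x = ext.q y) : ext.extDist x y = ext.d x y :=
  if_pos h

theorem extDist_of_ne {x y : W} (h : ext.q x ≠ ext.q y) : ext.extDist x y = ∞ :=
  if_neg h

theorem measurable_extDist [StandardBorelSpace V] :
    Measurable fun p : W × W => ext.extDist p.1 p.2 := by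
  classical
  have hs : MeasurableSet {p : W × W | ext.q p.1 = ext.q p.2} :=
    measurableSet_eq_fun (ext.measurable_q.comp measurable_fst)
      (ext.measurable_q.comp measurable_snd)
  exact Measurable.dite (s := {p : W × W | ext.q p.1 = ext.q p.2})
    (f := fun p => ext.d p.1.1 p.1.2) ext.measurable_d (g := fun _ => ∞) measurable_const hs

theorem eq_of_extDist_eq_zero (x y : W) (h : ext.extDist x y = 0) : x = y := by
  by_cases hxy : ext.q x = ext.q y
  · exact (ext.d_eq_zero_iff x y hxy).1 (by rwa [← ext.extDist_of_eq hxy])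
  · simp [ext.extDist_of_ne hxy] at h

theorem extDist_comm (x y : W) : ext.extDist x y = ext.extDist y x := by
  by_cases hxy : ext.q x = ext.q y
  · rw [ext.extDist_of_eq hxy, ext.extDist_of_eq hxy.symm, ext.d_comm x y hxy]
  · rw [ext.extDist_of_ne hxy, ext.extDist_of_ne (Ne.symm hxy)]

theorem extDist_triangle (x y z : W) : ext.extDist x z ≤ ext.extDist x y + ext.extDist y z := by
  by_cases hxy : ext.q x = ext.q y
  · by_cases hyz : ext.q y = ext.q z
    · rw [ext.extDist_of_eq hxy, ext.extDist_of_eq hyz, ext.extDist_of_eq (hxy.trans hyz)]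
      exact ext.d_triangle x y z hxy hyz
    · simp [ext.extDist_of_ne hyz]
  · simp [ext.extDist_of_ne hxy]

theorem extDist_smul (g : Γ) (x y : W) : ext.extDist (g • x) (g • y) = ext.extDist x y := by
  by_cases hxy : ext.q x = ext.q y
  · rw [ext.extDist_of_eq hxy, ext.extDist_of_eq (by rw [ext.q_smul, ext.q_smul, hxy]),
      ext.d_smul g x y hxy]
  · rw [ext.extDist_of_ne hxy, ext.extDist_of_ne]
    rwa [ext.q_smul, ext.q_smul, (MulAction.injective g).ne_iff]

theorem exists_countable_extDist_dense (v : V) : ∃ S : Set W, S.Countable ∧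
    ∀ x, ext.q x = v → ∀ ε : ℝ≥0∞, 0 < ε → ∃ s ∈ S, ext.extDist x s < ε := by
  obtain ⟨S, hS, hSv, hdense⟩ := ext.separable v
  refine ⟨S, hS, fun x hx ε hε => ?_⟩
  obtain ⟨s, hs, hlt⟩ := hdense x hx ε hε
  exact ⟨s, hs, by rwa [ext.extDist_of_eq (hx.trans (hSv s hs).symm)]⟩

end SeparableMetricExtension

/-! ### Equivariant functions of a walk that depend on its future -/

/-- Locally compact second countable groups are Polish, hence standard Borel. -/
theorem standardBorelSpace_of_locallyCompact_group (Γ : Type*) [Group Γ] [TopologicalSpace Γ]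
    [IsTopologicalGroup Γ] [LocallyCompactSpace Γ] [SecondCountableTopology Γ] [T2Space Γ]
    [MeasurableSpace Γ] [BorelSpace Γ] : StandardBorelSpace Γ := by
  let _ : UniformSpace Γ := IsTopologicalGroup.rightUniformSpace Γ
  have : IsRightUniformGroup Γ := ⟨rfl⟩
  have := IsRightUniformGroup.completeSpace_of_weaklyLocallyCompactSpace (G := Γ)
  have : (uniformity Γ).IsCountablyGenerated := by
    rw [uniformity_eq_comap_mul_inv_nhds_one]
    infer_instance
  have : PolishSpace Γ := inferInstance
  infer_instance

namespace Greg

variable {X Γ : Type*} [MeasurableSpace X] [StandardBorelSpace X] [Group Γ]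
    [TopologicalSpace Γ] [IsTopologicalGroup Γ] [LocallyCompactSpace Γ]
    [SecondCountableTopology Γ] [T2Space Γ] [MeasurableSpace Γ] [BorelSpace Γ]
    (G : Greg X Γ)

theorem cocycle_zero (x : X) : G.cocycle 0 x = 1 := rfl

theorem cocycle_one (x : X) : G.cocycle 1 x = G.w x := by
  have := G.cocycle_add_one 0 x
  rwa [zero_add, cocycle_zero, one_mul] at this

theorem cocycle_add_natCast (j : ℤ) (n : ℕ) (x : X) :
    G.cocycle (j + n) x = G.cocycle j (G.T^[n] x) * G.cocycle n x := by
  induction n generalizing x with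
  | zero => simp [cocycle_zero]
  | succ n ih =>
    push_cast
    rw [← add_assoc, cocycle_add_one, ih, cocycle_add_one, mul_assoc, Function.iterate_succ_apply]

/-- The increments `w_k(x) = γ_k γ_0⁻¹`, `k ≥ 0`, of a walk `γ` that starts from `(x, g)`. -/
def futureCocycle (x : X) : ℕ → Γ := fun k => G.cocycle k x

theorem measurable_futureCocycle : Measurable G.futureCocycle :=
  measurable_pi_lambda _ fun k => G.measurable_cocycle k

/-- The map on sequences that corresponds to `T` under `futureCocycle`. -/
def rebase {Γ : Type*} [Group Γ] (z : ℕ → Γ) : ℕ → Γ := fun k => z (k + 1) * (z 1)⁻¹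

theorem measurable_rebase {Γ : Type*} [Group Γ] [TopologicalSpace Γ] [IsTopologicalGroup Γ]
    [SecondCountableTopology Γ] [MeasurableSpace Γ] [BorelSpace Γ] :
    Measurable (rebase : (ℕ → Γ) → ℕ → Γ) :=
  measurable_pi_lambda _ fun k => (measurable_pi_apply (k + 1)).mul (measurable_pi_apply 1).inv

theorem futureCocycle_T (x : X) : G.futureCocycle (G.T x) = rebase (G.futureCocycle x) := by
  funext k
  simp only [futureCocycle, rebase, Nat.cast_add, Nat.cast_one, cocycle_add_one, cocycle_one,
    mul_inv_cancel_right]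

theorem future_walk (p : X × Γ) : future (G.walk p) = rightAct p.2 (G.futureCocycle p.1) := rfl

theorem measurable_cocycle_iSup (j : ℤ) :
    Measurable[⨆ n, backwardFiltration G.T G.measurable_futureCocycle measurable_rebase
      G.futureCocycle_T n] (G.cocycle j) := by
  set 𝓕 := backwardFiltration G.T G.measurable_futureCocycle measurable_rebase
      G.futureCocycle_T
  let n := j.natAbs
  obtain ⟨k, hk⟩ : ∃ k : ℕ, j + n = k := ⟨(j + n).toNat, by omega⟩
  have h1 : G.cocycle j = (fun z : ℕ → Γ => z k * (z n)⁻¹) ∘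
      fun x => G.futureCocycle (G.T.symm^[n] x) := by
    funext x
    have hx : G.T^[n] (G.T.symm^[n] x) = x :=
      Function.LeftInverse.iterate (fun y => G.T.apply_symm_apply y) n x
    have := G.cocycle_add_natCast j n (G.T.symm^[n] x)
    rw [hx, hk] at this
    simp only [Function.comp_apply, futureCocycle, this, mul_inv_cancel_right]
  have h2 : Measurable[𝓕 n] fun x => G.futureCocycle (G.T.symm^[n] x) := comap_measurable _
  rw [h1]
  exact ((measurable_pi_apply k).mul (measurable_pi_apply n).inv).comp
    (h2.mono (le_iSup (fun n => 𝓕 n) n) le_rfl)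

variable {ν : Measure Γ} [IsProbabilityMeasure ν]
  {W V : Type*} [MeasurableSpace W] [StandardBorelSpace W]
  [MeasurableSpace V] [StandardBorelSpace V] [MulAction Γ W] [MeasurableSMul₂ Γ W]
  [MulAction Γ V] [MeasurableSMul₂ Γ V] {F : (ℤ → Γ) → W}

/-- An almost everywhere equivariant function of the walk is, for almost every base point `g₀`,
determined by its values at the starting points `(x, g₀)`. -/
theorem ae_ae_walk_eq_smul (hν : SameMeasureClass ν Measure.haar) (hFm : Measurable F)
    (hFρ : ∀ g : Γ, ∀ᵐ γ ∂(G.walkMeasure ν), F (rightAct g γ) = g • F γ) :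
    ∀ᵐ g₀ ∂ν, ∀ᵐ p ∂(G.m.prod ν), F (G.walk p) = p.2 • g₀⁻¹ • F (G.walk (p.1, g₀)) := by
  have := G.isProbabilityMeasure
  have h1 : ∀ h : Γ, ∀ᵐ p ∂(G.m.prod ν), F (G.walk (p.1, h * p.2)) = h • F (G.walk p) := fun h => by
    filter_upwards [ae_of_ae_map G.measurable_walk.aemeasurable (hFρ h)] with p hp
    rw [← hp, rightAct_walk]
  have hD : MeasurableSet {q : (Γ × X) × Γ |
      F (G.walk (q.1.2, q.1.1 * q.2)) = q.1.1 • F (G.walk (q.1.2, q.2))} := by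
    refine measurableSet_eq_fun (hFm.comp (G.measurable_walk.comp ?_)) (Measurable.smul ?_
      (hFm.comp (G.measurable_walk.comp ?_)))
    all_goals fun_prop
  have h2 : ∀ᵐ q ∂(ν.prod G.m), ∀ᵐ g ∂ν,
      F (G.walk (q.2, q.1 * g)) = q.1 • F (G.walk (q.2, g)) := by
    have h3 : ∀ᵐ q ∂((ν.prod G.m).prod ν),
        F (G.walk (q.1.2, q.1.1 * q.2)) = q.1.1 • F (G.walk (q.1.2, q.2)) := by
      have h4 : ∀ᵐ q ∂(ν.prod (G.m.prod ν)),
          F (G.walk (q.2.1, q.1 * q.2.2)) = q.1 • F (G.walk q.2) := by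
        refine (Measure.ae_prod_iff_ae_ae ?_).2 (ae_of_all _ h1)
        exact MeasurableEquiv.prodAssoc.symm.measurable hD
      exact (measurePreserving_prodAssoc ν G.m ν).quasiMeasurePreserving.ae h4
    exact Measure.ae_ae_of_ae_prod h3
  filter_upwards [(Measure.ae_ae_comm hD).1 h2] with g hg
  have hq : Measure.QuasiMeasurePreserving (fun p : X × Γ => (p.2 * g⁻¹, p.1))
      (G.m.prod ν) (ν.prod G.m) :=
    Measure.measurePreserving_swap.quasiMeasurePreserving.comp
      (G.quasiMeasurePreserving_skew hν (MeasurePreserving.id G.m) (c := fun _ => g⁻¹)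
        measurable_const)
  filter_upwards [hq.ae hg] with p hp
  simp only [inv_mul_cancel_right] at hp
  rw [← mul_smul, ← hp]

/-- An equivariant shift invariant function `F` of the walk with values in a metric extension
`W → V` is determined by the future of the walk if its image in `V` is. -/
theorem exists_factorization_future (hν : SameMeasureClass ν Measure.haar)
    (ext : SeparableMetricExtension Γ W V) (hFm : Measurable F)
    (hFρ : ∀ g : Γ, ∀ᵐ γ ∂(G.walkMeasure ν), F (rightAct g γ) = g • F γ)
    (hFS : ∀ᵐ γ ∂(G.walkMeasure ν), F (shiftZ γ) = F γ) {f : (ℕ → Γ) → V} (hf : Measurable f)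
    (hqF : ∀ᵐ γ ∂(G.walkMeasure ν), ext.q (F γ) = f (future γ)) :
    ∃ Φ : (ℕ → Γ) → W, Measurable Φ ∧ ∀ᵐ γ ∂(G.walkMeasure ν), F γ = Φ (future γ) := by
  have := G.isProbabilityMeasure
  have : Nonempty W := ⟨F fun _ => 1⟩
  have hwalk := G.measurable_walk
  have hqF' : ∀ᵐ g ∂ν, ∀ᵐ x ∂G.m, ext.q (F (G.walk (x, g))) = f (future (G.walk (x, g))) := by
    refine (Measure.ae_ae_comm (p := fun x g => ext.q (F (G.walk (x, g))) =
      f (future (G.walk (x, g)))) ?_).1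
      (Measure.ae_ae_of_ae_prod (ae_of_ae_map hwalk.aemeasurable hqF))
    exact measurableSet_eq_fun (ext.measurable_q.comp (hFm.comp hwalk))
      (hf.comp (measurable_future.comp hwalk))
  obtain ⟨g₀, hg₀, hg₀V⟩ := ((G.ae_ae_walk_eq_smul hν hFm hFρ).and hqF').exists
  let F₀ : X → W := fun x => g₀⁻¹ • F (G.walk (x, g₀))
  have hg : ∀ᵐ p ∂(G.m.prod ν), F (G.walk p) = p.2 • F₀ p.1 := hg₀
  have hF₀m : Measurable F₀ := (hFm.comp (hwalk.comp measurable_prodMk_right)).const_smul g₀⁻¹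
  have hF₀T : ∀ᵐ x ∂G.m, F₀ (G.T x) = G.futureCocycle x 1 • F₀ x := by
    have hskew := G.quasiMeasurePreserving_skew hν G.measurePreserving G.measurable_w.inv
    have h : ∀ᵐ p ∂(G.m.prod ν), F₀ (G.T p.1) = G.futureCocycle p.1 1 • F₀ p.1 := by
      filter_upwards [hg, hskew.ae hg, ae_of_ae_map hwalk.aemeasurable hFS] with p h1 h2 h3
      rw [shiftZ_walk, h1] at h3
      have h4 := h2.symm.trans h3
      have hc : G.futureCocycle p.1 1 = G.w p.1 := G.cocycle_one p.1
      rw [mul_smul, smul_left_cancel_iff, Pi.inv_apply, inv_smul_eq_iff] at h4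
      rw [hc, h4]
    filter_upwards [Measure.ae_ae_of_ae_prod h] with x hx
    obtain ⟨-, hx⟩ := hx.exists
    exact hx
  have hF₀V : ∀ᵐ x ∂G.m, ext.q (F₀ x) = g₀⁻¹ • f (rightAct g₀ (G.futureCocycle x)) := by
    filter_upwards [hg₀V] with x hx
    rw [ext.q_smul, hx, future_walk]
  have hF₀Z : Measurable[⨆ n, backwardFiltration G.T G.measurable_futureCocycle measurable_rebase
      G.futureCocycle_T n] F₀ := by
    have h : Measurable[⨆ n, backwardFiltration G.T G.measurable_futureCocycle measurable_rebase
        G.futureCocycle_T n] fun x => G.walk (x, g₀) :=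
      @measurable_pi_lambda _ _ _ (_) _ _ fun j =>
        (measurable_mul_const g₀⁻¹).comp (G.measurable_cocycle_iSup j)
    exact (hFm.const_smul g₀⁻¹).comp h
  obtain ⟨φ, hφ, hφF⟩ := exists_factorization_of_isometric_extension G.measurePreserving
    G.measurable_futureCocycle measurable_rebase G.futureCocycle_T (c := fun z : ℕ → Γ => z 1)
    (measurable_pi_apply 1) hF₀m hF₀Z hF₀T ext.measurable_extDist ext.eq_of_extDist_eq_zero
    ext.extDist_comm ext.extDist_triangle ext.extDist_smul ext.measurable_q
    ((hf.comp (measurable_rightAct.comp measurable_prodMk_left)).const_smul g₀⁻¹) hF₀V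
    ext.exists_countable_extDist_dense
  let Φ : (ℕ → Γ) → W := fun z => (z 0)⁻¹ • φ (rightAct (z 0) z)
  have hΦ : Measurable Φ := (measurable_pi_apply 0).inv.smul
    (hφ.comp (measurable_rightAct.comp ((measurable_pi_apply 0).prodMk measurable_id)))
  refine ⟨Φ, hΦ, (ae_map_iff hwalk.aemeasurable (measurableSet_eq_fun hFm
    (hΦ.comp measurable_future))).2 ?_⟩
  filter_upwards [hg, Measure.quasiMeasurePreserving_fst.ae hφF] with p h1 h2
  have h0 : future (G.walk p) 0 = p.2⁻¹ := by
    simp [future, walk, cocycle_zero]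
  have h3 : rightAct p.2⁻¹ (future (G.walk p)) = G.futureCocycle p.1 := by
    funext k
    simp [future_walk, rightAct]
  change _ = (future (G.walk p) 0)⁻¹ • φ (rightAct (future (G.walk p) 0) (future (G.walk p)))
  rw [h0, h3, inv_inv, h1, h2]

/-! ### Time reversal -/

/-- The Greg with the time reversed: it generates the cocycle `n ↦ w_{-n}` over `T⁻¹`. -/
def reverse : Greg X Γ where
  m := G.m
  isProbabilityMeasure := G.isProbabilityMeasure
  T := G.T.symm
  measurePreserving := G.measurePreserving.symm G.T
  w x := (G.w (G.T.symm x))⁻¹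
  measurable_w := (G.measurable_w.comp G.T.symm.measurable).inv

theorem reverse_cocycle (n : ℤ) (x : X) : G.reverse.cocycle n x = G.cocycle (-n) x := by
  induction n generalizing x with
  | zero => rfl
  | succ n ih =>
    have h := G.cocycle_add_one (-(n + 1)) (G.T.symm x)
    rw [G.T.apply_symm_apply, neg_add, neg_add_cancel_right] at h
    rw [cocycle_add_one, ih, neg_add]
    exact mul_inv_eq_of_eq_mul h
  | pred n ih =>
    have h := G.reverse.cocycle_add_one (-n - 1) (G.T x)
    have hT : G.reverse.T (G.T x) = x := G.T.symm_apply_apply x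
    have hw : G.reverse.w (G.T x) = (G.w x)⁻¹ :=
      congrArg (fun y => (G.w y)⁻¹) (G.T.symm_apply_apply x)
    rw [sub_add_cancel, ih, hT, hw, eq_mul_inv_iff_mul_eq, neg_neg] at h
    rw [← h, neg_sub, sub_neg_eq_add, add_comm, cocycle_add_one]

/-- The time reversal of a bi-infinite sequence. -/
def flipZ {Γ : Type*} (γ : ℤ → Γ) : ℤ → Γ := fun n => γ (-n)

theorem flipZ_flipZ {Γ : Type*} (γ : ℤ → Γ) : flipZ (flipZ γ) = γ := by
  funext n
  simp [flipZ]

theorem measurable_flipZ {Γ : Type*} [MeasurableSpace Γ] : Measurable (flipZ : (ℤ → Γ) → ℤ → Γ) :=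
  measurable_pi_lambda _ fun _ => measurable_pi_apply _

theorem reverse_walk (p : X × Γ) : G.reverse.walk p = flipZ (G.walk p) := by
  funext n
  simp [walk, flipZ, reverse_cocycle]

theorem reverse_walkMeasure (ν : Measure Γ) : G.reverse.walkMeasure ν = (G.walkMeasure ν).map flipZ := by
  rw [walkMeasure, walkMeasure, Measure.map_map measurable_flipZ G.measurable_walk]
  exact congrArg (Measure.map · _) (funext G.reverse_walk)

omit [IsProbabilityMeasure ν] in
theorem ae_reverse_walkMeasure_iff {p : (ℤ → Γ) → Prop} (hp : MeasurableSet {γ | p γ}) :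
    (∀ᵐ γ ∂(G.reverse.walkMeasure ν), p γ) ↔ ∀ᵐ γ ∂(G.walkMeasure ν), p (flipZ γ) := by
  rw [reverse_walkMeasure]
  exact ae_map_iff measurable_flipZ.aemeasurable hp

theorem ae_comp_unshiftZ_eq (hν : SameMeasureClass ν Measure.haar) {Y : Type*} {F : (ℤ → Γ) → Y}
    (hFS : ∀ᵐ γ ∂(G.walkMeasure ν), F (shiftZ γ) = F γ) :
    ∀ᵐ γ ∂(G.walkMeasure ν), F (unshiftZ γ) = F γ := by
  filter_upwards [(G.quasiMeasurePreserving_unshiftZ hν).ae hFS] with γ hγ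
  rw [← hγ]
  congr 1
  funext n
  simp [shiftZ, unshiftZ]

theorem exists_factorization_past (hν : SameMeasureClass ν Measure.haar)
    (ext : SeparableMetricExtension Γ W V) (hFm : Measurable F)
    (hFρ : ∀ g : Γ, ∀ᵐ γ ∂(G.walkMeasure ν), F (rightAct g γ) = g • F γ)
    (hFS : ∀ᵐ γ ∂(G.walkMeasure ν), F (shiftZ γ) = F γ) {f : (ℕ → Γ) → V} (hf : Measurable f)
    (hqF : ∀ᵐ γ ∂(G.walkMeasure ν), ext.q (F γ) = f (past γ)) :
    ∃ Φ : (ℕ → Γ) → W, Measurable Φ ∧ ∀ᵐ γ ∂(G.walkMeasure ν), F γ = Φ (past γ) := by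
  have hFf : Measurable fun γ => F (flipZ γ) := hFm.comp measurable_flipZ
  have hunshift := G.ae_comp_unshiftZ_eq hν hFS
  obtain ⟨Φ, hΦ, hΦF⟩ := G.reverse.exists_factorization_future hν ext hFf
    (fun g => by
      refine (G.ae_reverse_walkMeasure_iff (measurableSet_eq_fun
        (hFf.comp (measurable_rightAct.comp measurable_prodMk_left)) (hFf.const_smul g))).2 ?_
      filter_upwards [hFρ g] with γ hγ
      change F (flipZ (rightAct g (flipZ γ))) = g • F (flipZ (flipZ γ))
      rw [flipZ_flipZ, ← hγ]
      congr 1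
      exact flipZ_flipZ (rightAct g γ))
    (by
      refine (G.ae_reverse_walkMeasure_iff (measurableSet_eq_fun
        (hFf.comp measurable_shiftZ) hFf)).2 ?_
      filter_upwards [hunshift] with γ hγ
      change F (flipZ (shiftZ (flipZ γ))) = F (flipZ (flipZ γ))
      rw [flipZ_flipZ, ← hγ]
      congr 1
      funext n
      simp only [flipZ, shiftZ, unshiftZ]
      congr 1
      ring)
    hf
    (by
      refine (G.ae_reverse_walkMeasure_iff (measurableSet_eq_fun
        (ext.measurable_q.comp hFf) (hf.comp measurable_future))).2 ?_
      filter_upwards [(G.quasiMeasurePreserving_shiftZ hν).ae hqF, hFS] with γ h1 h2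
      change ext.q (F (flipZ (flipZ γ))) = f (future (flipZ γ))
      rw [flipZ_flipZ, ← h2, h1]
      congr 1
      funext k
      simp only [past, shiftZ, future, flipZ]
      congr 1
      ring)
  refine ⟨Φ, hΦ, ?_⟩
  have h := (G.ae_reverse_walkMeasure_iff (measurableSet_eq_fun hFf
    (hΦ.comp measurable_future))).1 hΦF
  -- The reversed future starts at time `0` and the past at time `-1`: shift by one step.
  filter_upwards [(G.quasiMeasurePreserving_unshiftZ hν).ae h, hunshift] with γ h1 h2
  change F (flipZ (flipZ (unshiftZ γ))) = Φ (future (flipZ (unshiftZ γ))) at h1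
  rw [flipZ_flipZ, h2] at h1
  rw [h1]
  congr 1
  funext k
  simp only [past, unshiftZ, future, flipZ]
  congr 1
  ring

end Greg

/-! ### The boundary system of a Greg -/

theorem shiftN_past {Γ : Type*} (γ : ℤ → Γ) : shiftN (past γ) = past (Greg.unshiftZ γ) := by
  funext k
  simp only [past, Greg.unshiftZ, shiftN]
  congr 1
  push_cast
  ring

/-- For a process in `Γ`, the action on the ergodic components is non-singular and amenable:
`z ↦ (z i)⁻¹` is an equivariant map to `Γ`. -/
theorem ErgodicComponents.isNonsingularAction_and_isZimmerAmenable_rightAct {Γ ι E : Type*}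
    [Countable ι] [Group Γ] [TopologicalSpace Γ] [IsTopologicalGroup Γ] [LocallyCompactSpace Γ]
    [SecondCountableTopology Γ] [T2Space Γ] [MeasurableSpace Γ] [BorelSpace Γ]
    [MeasurableSpace E] [StandardBorelSpace E] {μ : Measure (ι → Γ)} [IsProbabilityMeasure μ]
    {S : (ι → Γ) → ι → Γ} (i : ι) (hS : Measure.QuasiMeasurePreserving S μ μ)
    (hρ : ∀ g : Γ, Measure.QuasiMeasurePreserving (rightAct g) μ μ)
    (hcomm : ∀ (g : Γ) z, rightAct g (S z) = S (rightAct g z))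
    (P : ErgodicComponents μ S (rightAct : Γ → (ι → Γ) → (ι → Γ)) E) :
    IsNonsingularAction P.act P.measure ∧ IsZimmerAmenable P.act P.measure := by
  have := standardBorelSpace_of_locallyCompact_group Γ
  refine ⟨P.isNonsingularAction hρ (fun z => ?_) fun g h z => ?_,
    P.isZimmerAmenable hS hρ hcomm (c := fun z => (z i)⁻¹) (measurable_pi_apply i).inv
      fun g z => ?_⟩
  · funext i
    simp [rightAct]
  · funext i
    simp [rightAct, mul_assoc]
  · simp [rightAct]

namespace Greg

variable {X Γ : Type*} [MeasurableSpace X] [StandardBorelSpace X] [Group Γ]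
    [TopologicalSpace Γ] [IsTopologicalGroup Γ] [LocallyCompactSpace Γ]
    [SecondCountableTopology Γ] [T2Space Γ] [MeasurableSpace Γ] [BorelSpace Γ]
    (G : Greg X Γ) {ν : Measure Γ} [IsProbabilityMeasure ν]
    {E E' : Type*} [MeasurableSpace E] [StandardBorelSpace E] [MeasurableSpace E']
    [StandardBorelSpace E'] {r : (ℤ → Γ) → ℕ → Γ}

theorem quasiMeasurePreserving_rightAct_map (hν : SameMeasureClass ν Measure.haar)
    (hr : Measurable r) (hrρ : ∀ g γ, r (rightAct g γ) = rightAct g (r γ)) (g : Γ) :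
    Measure.QuasiMeasurePreserving (rightAct g) ((G.walkMeasure ν).map r)
      ((G.walkMeasure ν).map r) :=
  quasiMeasurePreserving_map_of_semiconj hr (G.quasiMeasurePreserving_rightAct hν g)
    (measurable_rightAct.comp measurable_prodMk_left) fun γ => (hrρ g γ).symm

theorem isGammaMap_comparison (hν : SameMeasureClass ν Measure.haar) (hr : Measurable r)
    (hrρ : ∀ g γ, r (rightAct g γ) = rightAct g (r γ)) (P : G.FullSpace ν E)
    (Q : ErgodicComponents ((G.walkMeasure ν).map r) shiftN
      (rightAct : Γ → (ℕ → Γ) → (ℕ → Γ)) E')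
    {π : E → E'} (hπ : Measurable π)
    (hπQ : ∀ᵐ γ ∂(G.walkMeasure ν), π (P.factor γ) = Q.factor (r γ)) :
    IsGammaMap P.act P.measure Q.act π := by
  refine P.isGammaMap_of_comp_factor (G.quasiMeasurePreserving_rightAct hν)
    Q.measurable_act_const hπ hπQ fun g => ?_
  filter_upwards [ae_of_ae_map hr.aemeasurable (Q.factor_equivariant g)] with γ hγ
  rw [hrρ, hγ]

/-- If a `Γ`-map on the space of ergodic components of the walk depends only on `r γ`, then it
factors through the space of ergodic components of the process `r γ`. -/
theorem exists_gammaMap_of_factorization (hν : SameMeasureClass ν Measure.haar)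
    (hr : Measurable r) (hrρ : ∀ g γ, r (rightAct g γ) = rightAct g (r γ))
    {σ : (ℤ → Γ) → ℤ → Γ}
    (hσ : Measure.QuasiMeasurePreserving σ (G.walkMeasure ν) (G.walkMeasure ν))
    (hrσ : ∀ γ, shiftN (r γ) = r (σ γ)) (P : G.FullSpace ν E)
    (hPσ : ∀ᵐ γ ∂(G.walkMeasure ν), P.factor (σ γ) = P.factor γ)
    (Q : ErgodicComponents ((G.walkMeasure ν).map r) shiftN
      (rightAct : Γ → (ℕ → Γ) → (ℕ → Γ)) E')
    {π : E → E'} (hπ : Measurable π)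
    (hπQ : ∀ᵐ γ ∂(G.walkMeasure ν), π (P.factor γ) = Q.factor (r γ))
    {W : Type*} [MeasurableSpace W] [StandardBorelSpace W] [MulAction Γ W] [MeasurableSMul₂ Γ W]
    {F : E → W} (hF : IsGammaMap P.act P.measure (fun g x => g • x) F)
    {Φ : (ℕ → Γ) → W} (hΦ : Measurable Φ)
    (hΦF : ∀ᵐ γ ∂(G.walkMeasure ν), F (P.factor γ) = Φ (r γ)) :
    ∃ φ : E' → W, IsGammaMap Q.act Q.measure (fun g x => g • x) φ ∧
      ∀ᵐ x ∂P.measure, F x = φ (π x) := by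
  have := standardBorelSpace_of_locallyCompact_group Γ
  have : IsProbabilityMeasure ((G.walkMeasure ν).map r) :=
    Measure.isProbabilityMeasure_map hr.aemeasurable
  have hΦS : ∀ᵐ y ∂((G.walkMeasure ν).map r), Φ (shiftN y) = Φ y := by
    refine (ae_map_iff hr.aemeasurable (measurableSet_eq_fun
      (hΦ.comp measurable_shiftN) hΦ)).2 ?_
    filter_upwards [hΦF, hσ.ae hΦF, hPσ] with γ h1 h2 h3
    change Φ (shiftN (r γ)) = Φ (r γ)
    rw [hrσ, ← h2, h3, h1]
  have hΦρ : ∀ g : Γ, ∀ᵐ y ∂((G.walkMeasure ν).map r), Φ (rightAct g y) = g • Φ y := by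
    intro g
    refine (ae_map_iff hr.aemeasurable (measurableSet_eq_fun
      (hΦ.comp (measurable_rightAct.comp measurable_prodMk_left)) (hΦ.const_smul g))).2 ?_
    filter_upwards [hΦF, (G.quasiMeasurePreserving_rightAct hν g).ae hΦF,
      P.factor_equivariant g, ae_of_ae_map P.measurable_factor.aemeasurable (hF.equivariant g)]
      with γ h1 h2 h3 h4
    change Φ (rightAct g (r γ)) = g • Φ (r γ)
    rw [← hrρ, ← h2, h3, h4, h1]
  obtain ⟨φ, hφ, hφΦ⟩ := Q.exists_factorization Φ hΦ hΦS
  refine ⟨φ, Q.isGammaMap_of_comp_factor (G.quasiMeasurePreserving_rightAct_map hν hr hrρ)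
    (fun g => measurable_const_smul g) hφ hφΦ hΦρ, ?_⟩
  refine (P.ae_measure_iff (measurableSet_eq_fun hF.measurable (hφ.comp hπ))).2 ?_
  filter_upwards [hΦF, ae_of_ae_map hr.aemeasurable hφΦ, hπQ] with γ h1 h2 h3
  rw [Function.comp_apply, h1, h3, h2]

omit [IsProbabilityMeasure ν] in
theorem ae_factor_equivariant (P : G.FullSpace ν E) {W : Type*} [MeasurableSpace W]
    [MulAction Γ W] {F : E → W} (hF : IsGammaMap P.act P.measure (fun g x => g • x) F) (g : Γ) :
    ∀ᵐ γ ∂(G.walkMeasure ν), F (P.factor (rightAct g γ)) = g • F (P.factor γ) := by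
  filter_upwards [P.factor_equivariant g,
    ae_of_ae_map P.measurable_factor.aemeasurable (hF.equivariant g)] with γ h1 h2
  rw [h1, h2]

theorem isRelMetricallyErgodic_future (hν : SameMeasureClass ν Measure.haar)
    (P : G.FullSpace ν E) (Q : G.IdealFuture ν E') {π : E → E'} (hπ : Measurable π)
    (hπQ : ∀ᵐ γ ∂(G.walkMeasure ν), π (P.factor γ) = Q.factor (future γ)) :
    IsRelMetricallyErgodic.{v} P.act P.measure Q.act Q.measure π := by
  intro W V _ _ _ _ _ _ _ _ ext F f hF hf hqF
  obtain ⟨Φ, hΦ, hΦF⟩ := G.exists_factorization_future hν ext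
    (hF.measurable.comp P.measurable_factor) (G.ae_factor_equivariant P hF)
    (P.factor_comp_ae_eq.mono fun γ hγ => congrArg F hγ)
    (hf.measurable.comp Q.measurable_factor) (by
      filter_upwards [hπQ, ae_of_ae_map P.measurable_factor.aemeasurable hqF] with γ h1 h2
      rw [Function.comp_apply, Function.comp_apply, h2, h1])
  exact G.exists_gammaMap_of_factorization hν measurable_future (fun g γ => rfl)
    (G.quasiMeasurePreserving_shiftZ hν) (fun γ => rfl) P P.factor_comp_ae_eq Q hπ hπQ hF hΦ hΦF

theorem isRelMetricallyErgodic_past (hν : SameMeasureClass ν Measure.haar)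
    (P : G.FullSpace ν E) (Q : G.IdealPast ν E') {π : E → E'} (hπ : Measurable π)
    (hπQ : ∀ᵐ γ ∂(G.walkMeasure ν), π (P.factor γ) = Q.factor (past γ)) :
    IsRelMetricallyErgodic.{v} P.act P.measure Q.act Q.measure π := by
  intro W V _ _ _ _ _ _ _ _ ext F f hF hf hqF
  obtain ⟨Φ, hΦ, hΦF⟩ := G.exists_factorization_past hν ext
    (hF.measurable.comp P.measurable_factor) (G.ae_factor_equivariant P hF)
    (P.factor_comp_ae_eq.mono fun γ hγ => congrArg F hγ)
    (hf.measurable.comp Q.measurable_factor) (by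
      filter_upwards [hπQ, ae_of_ae_map P.measurable_factor.aemeasurable hqF] with γ h1 h2
      rw [Function.comp_apply, Function.comp_apply, h2, h1])
  exact G.exists_gammaMap_of_factorization hν measurable_past (fun g γ => rfl)
    (G.quasiMeasurePreserving_unshiftZ hν) shiftN_past P
    (G.ae_comp_unshiftZ_eq hν P.factor_comp_ae_eq) Q hπ hπQ hF hΦ hΦF

theorem isNonsingularAction_and_isZimmerAmenable_map (hν : SameMeasureClass ν Measure.haar)
    (hr : Measurable r) (hrρ : ∀ g γ, r (rightAct g γ) = rightAct g (r γ))
    {σ : (ℤ → Γ) → ℤ → Γ}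
    (hσ : Measure.QuasiMeasurePreserving σ (G.walkMeasure ν) (G.walkMeasure ν))
    (hrσ : ∀ γ, shiftN (r γ) = r (σ γ))
    (Q : ErgodicComponents ((G.walkMeasure ν).map r) shiftN
      (rightAct : Γ → (ℕ → Γ) → (ℕ → Γ)) E') :
    IsNonsingularAction Q.act Q.measure ∧ IsZimmerAmenable Q.act Q.measure := by
  have : IsProbabilityMeasure ((G.walkMeasure ν).map r) :=
    Measure.isProbabilityMeasure_map hr.aemeasurable
  exact Q.isNonsingularAction_and_isZimmerAmenable_rightAct 0
    (quasiMeasurePreserving_map_of_semiconj hr hσ measurable_shiftN hrσ)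
    (G.quasiMeasurePreserving_rightAct_map hν hr hrρ) fun g z => rfl

end Greg

theorem theoremT {X Γ : Type*} [MeasurableSpace X] [StandardBorelSpace X] [Group Γ]
    [TopologicalSpace Γ] [IsTopologicalGroup Γ] [LocallyCompactSpace Γ]
    [SecondCountableTopology Γ] [T2Space Γ] [MeasurableSpace Γ] [BorelSpace Γ]
    (G : Greg X Γ)
    (ν : Measure Γ) [IsProbabilityMeasure ν] (hν : SameMeasureClass ν Measure.haar)
    {E Ep Em : Type*} [MeasurableSpace E] [StandardBorelSpace E]
    [MeasurableSpace Ep] [StandardBorelSpace Ep] [MeasurableSpace Em] [StandardBorelSpace Em]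
    (P : G.FullSpace ν E) (Pp : G.IdealFuture ν Ep) (Pm : G.IdealPast ν Em)
    (πp : E → Ep) (hπp : Measurable πp)
    (hπp_comm : ∀ᵐ γ ∂(G.walkMeasure ν), πp (P.factor γ) = Pp.factor (future γ))
    (πm : E → Em) (hπm : Measurable πm)
    (hπm_comm : ∀ᵐ γ ∂(G.walkMeasure ν), πm (P.factor γ) = Pm.factor (past γ))
    (hApafic : G.IsApafic ν Pp Pm) :
    IsBoundarySystem.{v} P.act P.measure Pp.act Pp.measure Pm.act Pm.measure πp πm := by
  obtain ⟨hns, ham⟩ := P.isNonsingularAction_and_isZimmerAmenable_rightAct 0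
    (G.quasiMeasurePreserving_shiftZ hν) (G.quasiMeasurePreserving_rightAct hν) fun g z => rfl
  obtain ⟨hnsp, hamp⟩ := G.isNonsingularAction_and_isZimmerAmenable_map hν measurable_future
    (fun g γ => rfl) (G.quasiMeasurePreserving_shiftZ hν) (fun γ => rfl) Pp
  obtain ⟨hnsm, hamm⟩ := G.isNonsingularAction_and_isZimmerAmenable_map hν measurable_past
    (fun g γ => rfl) (G.quasiMeasurePreserving_unshiftZ hν) shiftN_past Pm
  refine ⟨hns, hnsp, hnsm,
    G.isGammaMap_comparison hν measurable_future (fun g γ => rfl) P Pp hπp hπp_comm,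
    G.isGammaMap_comparison hν measurable_past (fun g γ => rfl) P Pm hπm hπm_comm,
    ham, hamp, hamm, G.isRelMetricallyErgodic_future hν P Pp hπp hπp_comm,
    G.isRelMetricallyErgodic_past hν P Pm hπm hπm_comm, ?_⟩
  have hmap : P.measure.map (fun x => (πp x, πm x)) =
      (G.walkMeasure ν).map (fun γ => (Pp.factor (future γ), Pm.factor (past γ))) := by
    rw [ErgodicComponents.measure, Measure.map_map (hπp.prodMk hπm) P.measurable_factor]
    refine Measure.map_congr ?_
    filter_upwards [hπp_comm, hπm_comm] with γ h1 h2
    rw [Function.comp_apply, h1, h2]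
  rw [hmap]
  exact hApafic
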